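/- Theorem A. An algorithm is a deterministic multi-tape Turing machine. A time-complexity class $\mathcal C$ is given by a collection of proper (i.e. non-decreasing and computable in unary in time $O(n+f(n))$) time bounds $f:\mathbb N\to\mathbb N$ with $f(n)\ge n$ such that, for every $f$ in the collection and every integer $C\ge 1$, the function $n\mapsto C f(Cn+C)+C$ is also in the collection; a language belongs to $\mathcal C$ if it is decided by an algorithm in time $f(n)$ for some bound $f$ of the collection. $\mathrm{SubExp}$ is the class of languages decidable in time $f(n)$ for some $f$ with $\lim_{n\to\infty} f(n)/r^n=0$ for all $r>1$. For a group $G$ and a finite set $A$ of letters with a map $\pi: A\to G$ whose image generates $G$, let $WP(G,A)\subseteq (A\cup A^{-1})^*$ be the set of words over $A$ and its formal inverses that represent $1\in G$; the word problem of a group is in a class if $WP(G,A)$ is in it for some such $A$. Let $G$ be a finitely presented group whose word problem is in $\mathrm{SubExp}$. Suppose that $G$ has a subgroup of finite index which has a non-amenable quotient group $G_1$ whose word problem is in a time-complexity class $\mathcal C$ with $\mathcal C\subseteq\mathrm{SubExp}$. Then, for every finite generating set $A$ of $G$, $WP(G,A)$ is solvable with average-case complexity in $\mathcal C$ uniformly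 over all length-invariant discrete probability measures on $(A\cup A^{-1})^*$. That is, there are an algorithm $M$ that decides $WP(G,A)$, halting on each word $w$ after $T(w)<\infty$ steps, a positive non-decreasing time bound $f$ of $\mathcal C$, and a constant $0<C<\infty$ such that $$\sum_{w\in (A\cup A^{-1})^*}\frac{T(w)}{f(|w|)}\,\mu(w)\le C$$ for every probability measure $\mu:(A\cup A^{-1})^*\to[0,1]$ with $\mu(w)=\mu(w')$ whenever $|w|=|w'|$. -/

import Mathlib

open scoped ENNReal NNReal Topology

/-! ### Deterministic multi-tape Turing machines -/

/-- A deterministic multi-tape Turing machine with input alphabet `X`.  It has finitely many tapes,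
one of which is the input tape, a finite tape alphabet containing `X` and a blank symbol outside
`X`, and finitely many (non-halting) states.  In each step it looks at the current state and at
the symbols under all heads; it then passes to a new state or halts with answer `true` ("yes") or
`false` ("no"), and on every tape it overwrites the scanned symbol and moves the head by
`-1`, `0` or `1`. -/
structure TuringMachine (X : Type) where
  Tape : Type
  Symbol : Type
  State : Type
  finite_tape : Finite Tape
  finite_symbol : Finite Symbol
  finite_state : Finite State
  input : Tape
  blank : Symbol
  encode : X → Symbol
  encode_injective : Function.Injective encode
  encode_ne_blank : ∀ x, encode x ≠ blank
  start : State
  transition : State → (Tape → Symbol) → (State ⊕ Bool) × (Tape → Symbol × SignType)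

namespace TuringMachine

variable {X : Type}

/-- A configuration: the state (`Sum.inr b` means halted with answer `b`), the contents of the
two-way infinite tapes and the positions of the heads. -/
structure Config (M : TuringMachine X) where
  state : M.State ⊕ Bool
  content : M.Tape → ℤ → M.Symbol
  head : M.Tape → ℤ

/-- The initial configuration on `w`: the letters of `w` occupy the cells `0, …, |w| - 1` of the
input tape, all other cells of all tapes are blank, and all heads are at `0`. -/
noncomputable def init (M : TuringMachine X) (w : List X) : M.Config where
  state := Sum.inl M.start
  content := open Classical in fun τ i =>
    if h : τ = M.input ∧ 0 ≤ i ∧ i.toNat < w.length then M.encode (w[i.toNat]'h.2.2) else M.blank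
  head := fun _ => 0

/-- One step of the computation; halted configurations do not change. -/
def step (M : TuringMachine X) (c : M.Config) : M.Config :=
  match c.state with
  | Sum.inr _ => c
  | Sum.inl q =>
    let r := M.transition q fun τ => c.content τ (c.head τ)
    { state := r.1
      content := fun τ => Function.update (c.content τ) (c.head τ) (r.2 τ).1
      head := fun τ => c.head τ + ((r.2 τ).2 : ℤ) }

/-- The configuration after `t` steps on input `w`. -/
noncomputable def run (M : TuringMachine X) (w : List X) (t : ℕ) : M.Config :=
  M.step^[t] (M.init w)

/-- `M` decides the language `D`: on every input word it halts, with the correct answer. -/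
def Decides (M : TuringMachine X) (D : Language X) : Prop :=
  ∀ w : List X, ∃ (t : ℕ) (b : Bool), (M.run w t).state = Sum.inr b ∧ (b = true ↔ w ∈ D)

/-- The time `T(w)`: the number of steps after which `M` halts on `w` (it is only used for machines
that halt on every input). -/
noncomputable def time (M : TuringMachine X) (w : List X) : ℕ :=
  sInf {t : ℕ | ∃ b : Bool, (M.run w t).state = Sum.inr b}

/-- `M` decides `D` in time `f(n)`, where `n` is the length of the input. -/
def DecidesInTime (M : TuringMachine X) (D : Language X) (f : ℕ → ℕ) : Prop :=
  M.Decides D ∧ ∀ w : List X, M.time w ≤ f w.length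

end TuringMachine

/-! ### Complexity classes -/

/-- A class of languages over arbitrary finite alphabets. -/
abbrev LanguageClass : Type 1 := ∀ X : Type, Set (Language X)

/-- `f` is subexponential: `f(n) / r ^ n → 0` for every `r > 1`. -/
def Subexponential (f : ℕ → ℕ) : Prop :=
  ∀ r : ℝ, 1 < r → Filter.Tendsto (fun n : ℕ => (f n : ℝ) / r ^ n) Filter.atTop (𝓝 0)

/-- The languages decidable in deterministic subexponential time. -/
def SubExp : LanguageClass := fun X =>
  {D | ∃ f : ℕ → ℕ, Subexponential f ∧ ∃ M : TuringMachine X, M.DecidesInTime D f}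

/-- `f` is a proper complexity function: it is non-decreasing, and some machine computes `f(n)` in
unary notation from any input of length `n` in time `O(n + f(n))`.  (This is used only for `f` with
`f(n) ≥ n`; then the usual requirement that the machine also uses space `O(f(n))` follows from the
time bound.) -/
def IsProperComplexityFunction (f : ℕ → ℕ) : Prop :=
  Monotone f ∧
    ∃ (M : TuringMachine Unit) (output : M.Tape) (one : M.Symbol) (K : ℕ), one ≠ M.blank ∧
      ∀ n : ℕ, ∃ t ≤ K * (n + f n + 1), ∃ b : Bool,
        (M.run (List.replicate n ()) t).state = Sum.inr b ∧
        ∀ i : ℤ, (0 ≤ i ∧ i < (f n : ℤ) →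
            (M.run (List.replicate n ()) t).content output i = one) ∧
          (¬ (0 ≤ i ∧ i < (f n : ℤ)) →
            (M.run (List.replicate n ()) t).content output i = M.blank)

/-- A deterministic time-complexity class, given by the collection of its time bounds: proper
complexity functions `f` with `f(n) ≥ n`, such that with `f` also all the functions
`n ↦ C f(C n + C) + C` (for integers `C ≥ 1`) belong to the collection. -/
structure TimeClass where
  bounds : Set (ℕ → ℕ)
  proper : ∀ f ∈ bounds, IsProperComplexityFunction f
  le_bound : ∀ f ∈ bounds, ∀ n, n ≤ f n
  rescale : ∀ f ∈ bounds, ∀ C : ℕ, 1 ≤ C → (fun n => C * f (C * n + C) + C) ∈ bounds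

/-- The languages decidable within one of the time bounds of the class `𝒞`. -/
def TimeClass.languages (𝒞 : TimeClass) : LanguageClass := fun X =>
  {D | ∃ f ∈ 𝒞.bounds, ∃ M : TuringMachine X, M.DecidesInTime D f}

/-! ### Average-case complexity -/

/-- A discrete probability measure on words is length-invariant if words of equal length have
equal measure. -/
def LengthInvariant {X : Type} (μ : PMF (List X)) : Prop :=
  ∀ w w' : List X, w.length = w'.length → μ w = μ w'

/-- `M` solves `D` with average-case time-complexity bounded by `f`, uniformly relative to the
family `R` of discrete probability measures. -/
def TuringMachine.SolvesOnAverage {X : Type} (M : TuringMachine X) (D : Language X) (f : ℕ → ℕ)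
    (R : Set (PMF (List X))) : Prop :=
  M.Decides D ∧ Monotone f ∧ (∀ n, 0 < f n) ∧
    ∃ C : ℝ≥0, ∀ μ ∈ R,
      ∑' w : List X, (M.time w : ℝ≥0∞) / (f w.length : ℝ≥0∞) * μ w ≤ (C : ℝ≥0∞)

/-- `D` is solvable with average-case time-complexity in `𝒞`, uniformly relative to `R`. -/
def SolvableOnAverageIn {X : Type} (D : Language X) (𝒞 : TimeClass)
    (R : Set (PMF (List X))) : Prop :=
  ∃ M : TuringMachine X, ∃ f ∈ 𝒞.bounds, M.SolvesOnAverage D f R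

/-! ### Groups -/

/-- The group element represented by a word in the letters `a = (a, true)` and
`a⁻¹ = (a, false)`, where the letter `a` represents `π a`. -/
def wordValue {G : Type*} [Group G] {A : Type} (π : A → G) (w : List (A × Bool)) : G :=
  (w.map fun x => if x.2 then π x.1 else (π x.1)⁻¹).prod

/-- The word problem: the language of all words over `A ∪ A⁻¹` that represent `1`. -/
def wordProblem {G : Type*} [Group G] {A : Type} (π : A → G) : Language (A × Bool) :=
  {w : List (A × Bool) | wordValue π w = 1}

/-- The word problem of `G`, with respect to some finite generating set, belongs to the given class
of languages. -/
def WordProblemIn (G : Type*) [Group G] (K : LanguageClass) : Prop :=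
  ∃ (B : Type) (_ : Finite B) (ρ : B → G),
    Subgroup.closure (Set.range ρ) = ⊤ ∧ wordProblem ρ ∈ K (B × Bool)

open Classical in
/-- Amenability of a discrete group (Følner condition): for every finite `S ⊆ G` and `ε > 0` there
is a non-empty finite `F ⊆ G` such that, for each `s ∈ S`, at most `ε |F|` of the edges
`x — x s` of the Cayley graph with `x ∈ F` leave `F`. -/
def IsAmenableGroup (G : Type*) [Group G] : Prop :=
  ∀ (S : Finset G) (ε : ℝ), 0 < ε →
    ∃ F : Finset G, F.Nonempty ∧
      ∀ s ∈ S, ((F.filter fun x => x * s ∉ F).card : ℝ) ≤ ε * (F.card : ℝ)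

/-!
Rewriting a word letter by letter along the cosets of `H` is done by a finite-state transducer; it
reduces membership of a word in the kernel of `φ`, a subgroup of `H`, to the word problem of `G₁`.
So a machine can first run the fast algorithm for `G₁` as a guard, reject the words that fail this
test, and only on the others run the subexponential algorithm for `G`.

As `G₁` is not amenable, the Schreier graph of `G` modulo the kernel satisfies a linear
isoperimetric inequality.  By Cheeger's inequality its walk operator has a spectral gap, and a
random word of length `n` passes the guard with probability at most `r ^ n` for some `r < 1`, which
outweighs the subexponential time spent on such words.  Length-invariant measures are mixtures of
the uniform measures on the words of a given length, so it is enough to bound the mean time for each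
length.
-/

/-! ### Transducers -/

/-- A deterministic finite-state transducer: it reads a word over `X`, writes at most `bound`
letters of `Y` for each letter read, and accepts or rejects according to its final state. -/
structure Transducer (X Y : Type) where
  State : Type
  finite_state : Finite State
  start : State
  next : State → X → State
  output : State → X → List Y
  bound : ℕ
  length_output_le : ∀ q x, (output q x).length ≤ bound
  accept : State → Prop

namespace Transducer

variable {X Y : Type} (T : Transducer X Y)

/-- The word written while reading a word from a given state. -/
def translateFrom : T.State → List X → List Y
  | _, [] => []
  | q, x :: w => T.output q x ++ translateFrom (T.next q x) w

/-- The state reached by reading a word from a given state. -/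
def finalFrom (q : T.State) (w : List X) : T.State := w.foldl T.next q

/-- The output on the input `w`. -/
abbrev translate (w : List X) : List Y := T.translateFrom T.start w

/-- The state reached on the input `w`. -/
abbrev final (w : List X) : T.State := T.finalFrom T.start w

/-- The language of all accepted words whose translation belongs to `E`. -/
def preimage (E : Language Y) : Language X :=
  {w : List X | T.accept (T.final w) ∧ T.translate w ∈ E}

theorem length_translateFrom_le (q : T.State) (w : List X) :
    (T.translateFrom q w).length ≤ T.bound * w.length := by
  induction w generalizing q with
  | nil => simp [translateFrom]
  | cons x w ih =>
    calc (T.output q x ++ T.translateFrom (T.next q x) w).length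
        ≤ T.bound + T.bound * w.length := by
          rw [List.length_append]
          exact add_le_add (T.length_output_le q x) (ih _)
      _ = T.bound * (x :: w).length := by rw [List.length_cons]; ring

end Transducer

/-! ### Computations of Turing machines -/

namespace TuringMachine

variable {X Y : Type}

theorem run_add (M : TuringMachine X) (w : List X) (s t : ℕ) :
    M.run w (s + t) = M.step^[t] (M.run w s) := by
  rw [add_comm]
  exact Function.iterate_add_apply _ _ _ _

theorem step_of_halted {M : TuringMachine X} {c : M.Config} {b : Bool}
    (h : c.state = Sum.inr b) : M.step c = c := by
  simp only [step, h]

section HaltingTime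

variable {M : TuringMachine X} {w : List X} {t : ℕ}

theorem time_le {b : Bool} (h : (M.run w t).state = Sum.inr b) : M.time w ≤ t :=
  Nat.sInf_le ⟨b, h⟩

theorem run_eq_run_time {b : Bool} (h : (M.run w t).state = Sum.inr b) :
    M.run w t = M.run w (M.time w) := by
  obtain ⟨b', hb'⟩ : ∃ b', (M.run w (M.time w)).state = Sum.inr b' :=
    Nat.sInf_mem (s := {t : ℕ | ∃ b, (M.run w t).state = Sum.inr b}) ⟨t, b, h⟩
  obtain ⟨k, rfl⟩ := Nat.exists_eq_add_of_le (time_le h)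
  rw [run_add, Function.iterate_fixed (step_of_halted hb')]

theorem Decides.exists_state_run_time {D : Language X} (h : M.Decides D) (w : List X) :
    ∃ b : Bool, (M.run w (M.time w)).state = Sum.inr b ∧ (b = true ↔ w ∈ D) := by
  obtain ⟨t, b, hb, hD⟩ := h w
  exact ⟨b, run_eq_run_time hb ▸ hb, hD⟩

theorem exists_state_of_lt_time (h : t < M.time w) : ∃ q, (M.run w t).state = Sum.inl q := by
  cases hs : (M.run w t).state with
  | inl q => exact ⟨q, rfl⟩
  | inr b => exact absurd (time_le hs) h.not_ge

theorem iterate_step_of_simulates {N : TuringMachine Y} (g : M.Config → N.Config)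
    (hg : ∀ c q, c.state = Sum.inl q → N.step (g c) = g (M.step c)) (ht : t ≤ M.time w) :
    N.step^[t] (g (M.init w)) = g (M.run w t) := by
  induction t with
  | zero => rfl
  | succ t ih =>
    obtain ⟨q, hq⟩ := exists_state_of_lt_time ht
    rw [Function.iterate_succ_apply', ih (Nat.le_of_succ_le ht), hg _ q hq, run_add]
    rfl

end HaltingTime

/-- The machine that accepts every input. -/
def acceptAll (X : Type) [Finite X] : TuringMachine X where
  Tape := Unit
  Symbol := Option X
  State := Unit
  finite_tape := inferInstance
  finite_symbol := inferInstance
  finite_state := inferInstance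
  input := ()
  blank := none
  encode := some
  encode_injective := Option.some_injective X
  encode_ne_blank := Option.some_ne_none
  start := ()
  transition _ r := (Sum.inr true, fun τ => (r τ, 0))

theorem acceptAll_decidesInTime (X : Type) [Finite X] :
    (acceptAll X).DecidesInTime ⊤ fun _ => 1 :=
  ⟨fun _ => ⟨1, true, rfl, iff_of_true rfl trivial⟩, fun _ => time_le (b := true) rfl⟩

/-! ### Tapes -/

/-- The content of a two-way infinite tape with the word `l` in the cells `0, …, |l| - 1`. -/
def tapeOf {S : Type} (blank : S) (e : Y → S) (l : List Y) : ℤ → S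
  | Int.ofNat n => (l[n]?).elim blank e
  | Int.negSucc _ => blank

section TapeOf

variable {S : Type} (blank : S) (e : Y → S)

theorem tapeOf_natCast (l : List Y) (n : ℕ) : tapeOf blank e l n = (l[n]?).elim blank e := rfl

theorem tapeOf_nil : tapeOf blank e [] = fun _ => blank := by
  funext i
  cases i <;> rfl

theorem tapeOf_length (l : List Y) : tapeOf blank e l l.length = blank := by
  simp [tapeOf_natCast]

theorem tapeOf_append_cons (u : List Y) (x : Y) (v : List Y) :
    tapeOf blank e (u ++ x :: v) u.length = e x := by
  simp [tapeOf_natCast]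

variable {blank e} in
theorem tapeOf_natCast_ne (he : ∀ y, e y ≠ blank) {l : List Y} {n : ℕ} (hn : n < l.length) :
    tapeOf blank e l n ≠ blank := by
  simp [tapeOf_natCast, hn, he]

theorem update_tapeOf_length (l : List Y) (y : Y) :
    Function.update (tapeOf blank e l) l.length (e y) = tapeOf blank e (l ++ [y]) := by
  funext i
  obtain rfl | hi := eq_or_ne i l.length
  · simp [tapeOf_append_cons]
  rw [Function.update_of_ne hi]
  cases i with
  | ofNat n =>
    have hn : n ≠ l.length := fun h => hi (congrArg _ h)
    change (l[n]?).elim blank e = ((l ++ [y])[n]?).elim blank e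
    obtain hlt | hgt := hn.lt_or_gt
    · rw [List.getElem?_append_left hlt]
    · rw [List.getElem?_eq_none hgt.le, List.getElem?_eq_none (by simpa using hgt)]
  | negSucc n => rfl

end TapeOf

/-- The contents of the tapes and the positions of the heads. -/
abbrev Tapes (M : TuringMachine X) : Type := (M.Tape → ℤ → M.Symbol) × (M.Tape → ℤ)

section Tapes

variable {M : TuringMachine X}

/-- The part of a configuration other than its state. -/
def Config.tapes (c : M.Config) : M.Tapes := (c.content, c.head)

theorem Config.ext {c c' : M.Config} (hs : c.state = c'.state) (ht : c.tapes = c'.tapes) :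
    c = c' := by
  cases c
  cases c'
  simp_all [Config.tapes]

/-- The symbols under the heads. -/
def scanned (p : M.Tapes) (τ : M.Tape) : M.Symbol := p.1 τ (p.2 τ)

/-- The effect on the tapes of overwriting the scanned symbols and moving the heads. -/
def act (p : M.Tapes) (a : M.Tape → M.Symbol × SignType) : M.Tapes :=
  (fun τ => Function.update (p.1 τ) (p.2 τ) (a τ).1, fun τ => p.2 τ + ((a τ).2 : ℤ))

theorem step_state {c : M.Config} {q : M.State} (h : c.state = Sum.inl q) :
    (M.step c).state = (M.transition q (scanned c.tapes)).1 := by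
  simp only [step, h]
  rfl

theorem step_tapes {c : M.Config} {q : M.State} (h : c.state = Sum.inl q) :
    (M.step c).tapes = act c.tapes (M.transition q (scanned c.tapes)).2 := by
  simp only [step, h]
  rfl

/-- The action that changes nothing if the scanned symbols are `r`. -/
def idle (r : M.Tape → M.Symbol) (τ : M.Tape) : M.Symbol × SignType := (r τ, 0)

open Classical in
/-- The action, for scanned symbols `r`, that writes `s` on the input tape and then moves the head
of this tape by `d`. -/
noncomputable def writeInput (s : M.Symbol) (d : SignType) (r : M.Tape → M.Symbol) (τ : M.Tape) :
    M.Symbol × SignType := if τ = M.input then (s, d) else (r τ, 0)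

/-- The action, for scanned symbols `r`, that moves the head of the input tape by `d`. -/
noncomputable def moveInput (d : SignType) (r : M.Tape → M.Symbol) : M.Tape → M.Symbol × SignType :=
  writeInput (r M.input) d r

open Classical in
/-- The action, for scanned symbols `r`, that moves the head of the input tape to the left unless it
scans a blank. -/
noncomputable def rewindInput (r : M.Tape → M.Symbol) : M.Tape → M.Symbol × SignType :=
  if r M.input = M.blank then idle r else moveInput (-1) r

open Classical in
/-- The input tape contains the word `w` and its head is at `i`; all other tapes are blank. -/
noncomputable def wordTapes (M : TuringMachine X) (w : List X) (i : ℤ) : M.Tapes :=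
  (fun τ => if τ = M.input then tapeOf M.blank M.encode w else fun _ => M.blank,
    fun τ => if τ = M.input then i else 0)

theorem init_tapes (w : List X) : (M.init w).tapes = M.wordTapes w 0 := by
  refine Prod.ext (funext₂ fun τ i => ?_) (funext fun τ => ?_)
  · by_cases hτ : τ = M.input
    · cases i with
      | ofNat n =>
        by_cases hn : n < w.length <;> simp [Config.tapes, init, wordTapes, tapeOf, hτ, hn]
      | negSucc n => simp [Config.tapes, init, wordTapes, tapeOf, hτ]
    · simp [Config.tapes, init, wordTapes, hτ]
  · simp [Config.tapes, init, wordTapes]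

theorem scanned_wordTapes (w : List X) (i : ℤ) :
    scanned (M.wordTapes w i) M.input = tapeOf M.blank M.encode w i := by
  simp [scanned, wordTapes]

theorem act_idle (p : M.Tapes) : act p (idle (scanned p)) = p := by
  simp [act, idle, scanned]

theorem act_writeInput_wordTapes {w w' : List X} {i : ℤ} {s : M.Symbol} (d : SignType)
    (h : Function.update (tapeOf M.blank M.encode w) i s = tapeOf M.blank M.encode w') :
    act (M.wordTapes w i) (writeInput s d (scanned (M.wordTapes w i))) =
      M.wordTapes w' (i + d) := by
  refine Prod.ext (funext fun τ => ?_) (funext fun τ => ?_)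
  · by_cases hτ : τ = M.input
    · simp [act, writeInput, wordTapes, hτ, h]
    · simp [act, writeInput, wordTapes, hτ, scanned]
  · by_cases hτ : τ = M.input <;> simp [act, writeInput, wordTapes, hτ]

theorem act_append_wordTapes (w : List X) (x : X) :
    act (M.wordTapes w w.length) (writeInput (M.encode x) 1 (scanned (M.wordTapes w w.length))) =
      M.wordTapes (w ++ [x]) (w ++ [x]).length := by
  rw [act_writeInput_wordTapes 1 (update_tapeOf_length M.blank M.encode w x)]
  simp

theorem act_moveInput_wordTapes (w : List X) (i : ℤ) (d : SignType) :
    act (M.wordTapes w i) (moveInput d (scanned (M.wordTapes w i))) = M.wordTapes w (i + d) := by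
  refine act_writeInput_wordTapes d ?_
  rw [scanned_wordTapes, Function.update_eq_self]

theorem scanned_wordTapes_eq_blank_iff {w : List X} {n : ℕ} (hn : n ≤ w.length) :
    scanned (M.wordTapes w (n - 1)) M.input = M.blank ↔ n = 0 := by
  rw [scanned_wordTapes]
  cases n with
  | zero => exact iff_of_true rfl rfl
  | succ n =>
    have hne := tapeOf_natCast_ne M.encode_ne_blank (Nat.lt_of_succ_le hn)
    simpa using hne

theorem act_rewindInput_wordTapes {w : List X} {n : ℕ} (hn : n ≤ w.length) :
    act (M.wordTapes w (n - 1)) (rewindInput (scanned (M.wordTapes w (n - 1)))) =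
      M.wordTapes w ((n - 1 : ℕ) - 1) := by
  unfold rewindInput
  split_ifs with h
  · rw [act_idle, (scanned_wordTapes_eq_blank_iff hn).1 h]
  · have hn0 : n ≠ 0 := (scanned_wordTapes_eq_blank_iff hn).not.1 h
    rw [act_moveInput_wordTapes, Nat.cast_pred (Nat.pos_of_ne_zero hn0)]
    simp [sub_eq_add_neg]

end Tapes

/-! ### Running one machine as a guard for another one -/

section Guard

variable (T : Transducer X Y) (M : TuringMachine Y) (K : TuringMachine X)

/-- The states of the machine `TuringMachine.guard`: translating the input (`scan q l`, where `q` is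
the state of `T` and `l` is the part of its output that has not been written yet), returning the
heads to the beginning, running `M`, and running `K`. -/
inductive GuardState
  | scan (q : T.State) (l : {l : List Y // l.length ≤ T.bound})
  | rewind
  | guard (s : M.State)
  | main (s : K.State)

theorem finite_guardState [Finite Y] : Finite (GuardState T M K) := by
  have := T.finite_state
  have := M.finite_state
  have := K.finite_state
  have : Finite {l : List Y // l.length ≤ T.bound} := List.finite_length_le Y T.bound
  let e : (T.State × {l : List Y // l.length ≤ T.bound}) ⊕ Unit ⊕ M.State ⊕ K.State →
      GuardState T M K :=
    Sum.elim (fun p => .scan p.1 p.2) (Sum.elim (fun _ => .rewind) (Sum.elim .guard .main))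
  refine Finite.of_surjective e ?_
  rintro (⟨q, l⟩ | _ | s | s)
  exacts [⟨.inl (q, l), rfl⟩, ⟨.inr (.inl ()), rfl⟩, ⟨.inr (.inr (.inl s)), rfl⟩,
    ⟨.inr (.inr (.inr s)), rfl⟩]

variable {T M K}

/-- The state of `TuringMachine.guard` that corresponds to a state of `M`: where `M` accepts, `K`
starts. -/
def GuardState.ofGuard : M.State ⊕ Bool → GuardState T M K ⊕ Bool
  | Sum.inl s => Sum.inl (.guard s)
  | Sum.inr true => Sum.inl (.main K.start)
  | Sum.inr false => Sum.inr false

/-- The state of `TuringMachine.guard` that corresponds to a state of `K`. -/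
def GuardState.ofMain : K.State ⊕ Bool → GuardState T M K ⊕ Bool := Sum.map .main id

open Classical in
/-- The transitions of `TuringMachine.guard`, separately for the tapes of `K` and of `M`. -/
noncomputable def guardTransition (s : GuardState T M K) (k : K.Tape → K.Symbol)
    (m : M.Tape → M.Symbol) : (GuardState T M K ⊕ Bool) ×
      (K.Tape → K.Symbol × SignType) × (M.Tape → M.Symbol × SignType) :=
  match s with
  | .scan q ⟨y :: l, h⟩ =>
    (Sum.inl (.scan q ⟨l, (Nat.le_succ _).trans h⟩), idle k, writeInput (M.encode y) 1 m)
  | .scan q ⟨[], _⟩ =>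
    match Function.partialInv K.encode (k K.input) with
    | some x =>
      (Sum.inl (.scan (T.next q x) ⟨T.output q x, T.length_output_le q x⟩), moveInput 1 k, idle m)
    | none =>
      if T.accept q then (Sum.inl .rewind, moveInput (-1) k, moveInput (-1) m)
      else (Sum.inr false, idle k, idle m)
  | .rewind =>
    if k K.input = K.blank ∧ m M.input = M.blank then
      (Sum.inl (.guard M.start), moveInput 1 k, moveInput 1 m)
    else (Sum.inl .rewind, rewindInput k, rewindInput m)
  | .guard s => (GuardState.ofGuard (M.transition s m).1, idle k, (M.transition s m).2)
  | .main s => (GuardState.ofMain (K.transition s k).1, (K.transition s k).2, idle m)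

variable (T M K) in
/-- The machine that translates its input with `T`, runs `M` on the result and, if both `T` and `M`
accept, runs `K` on the input.  Symbols are pairs so that `K` and `M` keep their own alphabets. -/
noncomputable def guard [Finite Y] : TuringMachine X where
  Tape := K.Tape ⊕ M.Tape
  Symbol := K.Symbol × M.Symbol
  State := GuardState T M K
  finite_tape := by
    have := K.finite_tape
    have := M.finite_tape
    infer_instance
  finite_symbol := by
    have := K.finite_symbol
    have := M.finite_symbol
    infer_instance
  finite_state := finite_guardState T M K
  input := Sum.inl K.input
  blank := (K.blank, M.blank)
  encode x := (K.encode x, M.blank)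
  encode_injective _ _ h := K.encode_injective (Prod.ext_iff.1 h).1
  encode_ne_blank x h := K.encode_ne_blank x (Prod.ext_iff.1 h).1
  start := .scan T.start ⟨[], Nat.zero_le _⟩
  transition s r :=
    let a := guardTransition s (fun τ => (r (Sum.inl τ)).1) (fun τ => (r (Sum.inr τ)).2)
    (a.1, Sum.elim (fun τ => (((a.2.1 τ).1, M.blank), (a.2.1 τ).2))
      (fun τ => ((K.blank, (a.2.2 τ).1), (a.2.2 τ).2)))

theorem partialInv_encode_blank : Function.partialInv K.encode K.blank = none :=
  dif_neg fun ⟨x, hx⟩ => K.encode_ne_blank x hx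

open Classical in
theorem guardTransition_scan_end (w : List X) (q : T.State) (m : M.Tape → M.Symbol) :
    guardTransition (.scan q ⟨[], Nat.zero_le _⟩) (scanned (K.wordTapes w w.length)) m =
      if T.accept q then
        (Sum.inl .rewind, moveInput (-1) (scanned (K.wordTapes w w.length)), moveInput (-1) m)
      else (Sum.inr false, idle (scanned (K.wordTapes w w.length)), idle m) := by
  rw [guardTransition, scanned_wordTapes, tapeOf_length, partialInv_encode_blank]

/-- The number of steps of `TuringMachine.guard` before `M` starts. -/
def guardStart (T : Transducer X Y) (w : List X) : ℕ :=
  w.length + (T.translate w).length + 1 + (max w.length (T.translate w).length + 1)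

theorem guardStart_le (T : Transducer X Y) (w : List X) :
    guardStart T w ≤ (2 * T.bound + 2) * (w.length + 1) := by
  have hlength := T.length_translateFrom_le T.start w
  have hmax : max w.length (T.translate w).length ≤ w.length + (T.translate w).length :=
    max_le_add_of_nonneg (Nat.zero_le _) (Nat.zero_le _)
  rw [guardStart]
  nlinarith

variable [Finite Y]

/-- The configuration of `TuringMachine.guard` with given tapes of `K` and of `M`. -/
def glue (s : GuardState T M K ⊕ Bool) (k : K.Tapes) (m : M.Tapes) : (guard T M K).Config where
  state := s
  content := Sum.elim (fun τ i => (k.1 τ i, M.blank)) (fun τ i => (K.blank, m.1 τ i))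
  head := Sum.elim k.2 m.2

theorem step_glue {s : GuardState T M K} {k : K.Tapes} {m : M.Tapes}
    {s' : GuardState T M K ⊕ Bool} {a : K.Tape → K.Symbol × SignType}
    {b : M.Tape → M.Symbol × SignType}
    (h : guardTransition s (scanned k) (scanned m) = (s', a, b)) :
    (guard T M K).step (glue (Sum.inl s) k m) = glue s' (act k a) (act m b) := by
  have htransition : (guard T M K).transition s (scanned (glue (Sum.inl s) k m).tapes) =
      (s', Sum.elim (fun τ => (((a τ).1, M.blank), (a τ).2))
        (fun τ => ((K.blank, (b τ).1), (b τ).2))) := by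
    change (let r := guardTransition s (scanned k) (scanned m)
      (r.1, Sum.elim (fun τ => (((r.2.1 τ).1, M.blank), (r.2.1 τ).2))
        (fun τ => ((K.blank, (r.2.2 τ).1), (r.2.2 τ).2)))) = _
    rw [h]
  have hs : (glue (Sum.inl s) k m).state = Sum.inl s := rfl
  refine Config.ext ((step_state hs).trans (by rw [htransition]; rfl)) ?_
  rw [step_tapes hs, htransition]
  refine Prod.ext (funext₂ fun τ i => ?_) (funext fun τ => ?_)
  · rcases τ with τ | τ
    · change Function.update (fun i => (k.1 τ i, M.blank)) (k.2 τ) ((a τ).1, M.blank) i =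
        (Function.update (k.1 τ) (k.2 τ) (a τ).1 i, M.blank)
      simp only [Function.update_apply]
      split_ifs <;> rfl
    · change Function.update (fun i => (K.blank, m.1 τ i)) (m.2 τ) (K.blank, (b τ).1) i =
        (K.blank, Function.update (m.1 τ) (m.2 τ) (b τ).1 i)
      simp only [Function.update_apply]
      split_ifs <;> rfl
  · cases τ <;> rfl

theorem init_guard (w : List X) : (guard T M K).init w =
    glue (Sum.inl (.scan T.start ⟨[], Nat.zero_le _⟩)) (K.wordTapes w 0) (M.wordTapes [] 0) := by
  refine Config.ext rfl ?_
  rw [init_tapes]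
  refine Prod.ext (funext₂ fun τ i => ?_) (funext fun τ => ?_)
  · rcases τ with τ | τ
    · by_cases hτ : τ = K.input
      · cases i with
        | ofNat n =>
          by_cases hn : n < w.length <;>
            simp [Config.tapes, glue, guard, wordTapes, hτ, tapeOf, hn]
        | negSucc n => simp [Config.tapes, glue, guard, wordTapes, hτ, tapeOf]
      · simp [Config.tapes, glue, guard, wordTapes, hτ]
    · simp [Config.tapes, glue, guard, wordTapes, tapeOf_nil]
  · cases τ <;> simp [Config.tapes, glue, wordTapes]

theorem iterate_step_glue_emit (k : K.Tapes) (q : T.State) (l : List Y) (h : l.length ≤ T.bound)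
    (o : List Y) :
    (guard T M K).step^[l.length] (glue (Sum.inl (.scan q ⟨l, h⟩)) k (M.wordTapes o o.length)) =
      glue (Sum.inl (.scan q ⟨[], Nat.zero_le _⟩)) k (M.wordTapes (o ++ l) (o ++ l).length) := by
  induction l generalizing o with
  | nil => simp
  | cons y l ih =>
    rw [List.length_cons, Function.iterate_succ_apply, step_glue rfl, act_idle,
      act_append_wordTapes, ih ((Nat.le_succ _).trans h), List.append_assoc, List.singleton_append]

theorem step_glue_read (u : List X) (x : X) (v : List X) (q : T.State) (m : M.Tapes) :
    (guard T M K).step (glue (Sum.inl (.scan q ⟨[], Nat.zero_le _⟩))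
        (K.wordTapes (u ++ x :: v) u.length) m) =
      glue (Sum.inl (.scan (T.next q x) ⟨T.output q x, T.length_output_le q x⟩))
        (K.wordTapes (u ++ x :: v) (u ++ [x]).length) m := by
  have hx : Function.partialInv K.encode (scanned (K.wordTapes (u ++ x :: v) u.length) K.input) =
      some x := by
    rw [scanned_wordTapes, tapeOf_append_cons, Function.partialInv_left K.encode_injective]
  rw [step_glue (by rw [guardTransition, hx]), act_idle, act_moveInput_wordTapes]
  simp

theorem iterate_step_glue_scan (u v : List X) (q : T.State) (o : List Y) :
    (guard T M K).step^[v.length + (T.translateFrom q v).length]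
      (glue (Sum.inl (.scan q ⟨[], Nat.zero_le _⟩)) (K.wordTapes (u ++ v) u.length)
        (M.wordTapes o o.length)) =
      glue (Sum.inl (.scan (T.finalFrom q v) ⟨[], Nat.zero_le _⟩))
        (K.wordTapes (u ++ v) (u ++ v).length)
        (M.wordTapes (o ++ T.translateFrom q v) (o ++ T.translateFrom q v).length) := by
  induction v generalizing u q o with
  | nil => simp [Transducer.translateFrom, Transducer.finalFrom]
  | cons x v ih =>
    have hlength : (x :: v).length + (T.translateFrom q (x :: v)).length =
        v.length + (T.translateFrom (T.next q x) v).length + ((T.output q x).length + 1) := by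
      simp only [Transducer.translateFrom, List.length_cons, List.length_append]
      ring
    rw [hlength, Function.iterate_add_apply, Function.iterate_succ_apply, step_glue_read,
      iterate_step_glue_emit]
    simpa [Transducer.translateFrom, Transducer.finalFrom] using
      ih (u ++ [x]) (T.next q x) (o ++ T.output q x)

theorem guard_run_scan (w : List X) :
    (guard T M K).run w (w.length + (T.translate w).length) =
      glue (Sum.inl (.scan (T.final w) ⟨[], Nat.zero_le _⟩)) (K.wordTapes w w.length)
        (M.wordTapes (T.translate w) (T.translate w).length) := by
  rw [run, init_guard]
  exact iterate_step_glue_scan [] w T.start []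

theorem iterate_step_glue_rewind (w : List X) (o : List Y) {i j : ℕ} (hi : i ≤ w.length)
    (hj : j ≤ o.length) :
    (guard T M K).step^[max i j + 1]
        (glue (Sum.inl .rewind) (K.wordTapes w (i - 1)) (M.wordTapes o (j - 1))) =
      glue (Sum.inl (.guard M.start)) (K.wordTapes w 0) (M.wordTapes o 0) := by
  induction h : max i j generalizing i j with
  | zero =>
    obtain ⟨rfl, rfl⟩ : i = 0 ∧ j = 0 := by omega
    have hblank := And.intro ((scanned_wordTapes_eq_blank_iff (M := K) hi).2 rfl)
      ((scanned_wordTapes_eq_blank_iff (M := M) hj).2 rfl)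
    rw [zero_add, Function.iterate_one, step_glue (by rw [guardTransition, if_pos hblank]),
      act_moveInput_wordTapes, act_moveInput_wordTapes]
    simp
  | succ n ih =>
    have hblank : ¬ (scanned (K.wordTapes w (i - 1)) K.input = K.blank ∧
        scanned (M.wordTapes o (j - 1)) M.input = M.blank) := by
      rw [scanned_wordTapes_eq_blank_iff hi, scanned_wordTapes_eq_blank_iff hj]
      omega
    rw [Function.iterate_succ_apply, step_glue (by rw [guardTransition, if_neg hblank]),
      act_rewindInput_wordTapes hi, act_rewindInput_wordTapes hj]
    exact ih (by omega) (by omega) (by omega)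

theorem guard_run_guardStart {w : List X} (h : T.accept (T.final w)) :
    (guard T M K).run w (guardStart T w) =
      glue (Sum.inl (.guard M.start)) (K.wordTapes w 0) (M.wordTapes (T.translate w) 0) := by
  rw [guardStart, run_add, run_add, guard_run_scan, Function.iterate_one,
    step_glue (by rw [guardTransition_scan_end, if_pos h]), act_moveInput_wordTapes,
    act_moveInput_wordTapes]
  exact iterate_step_glue_rewind w (T.translate w) le_rfl le_rfl

theorem iterate_step_glue_guard (k : K.Tapes) (o : List Y) :
    (guard T M K).step^[M.time o] (glue (Sum.inl (.guard M.start)) k (M.wordTapes o 0)) =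
      glue (GuardState.ofGuard (M.run o (M.time o)).state) k (M.run o (M.time o)).tapes := by
  rw [← init_tapes]
  refine iterate_step_of_simulates (N := guard T M K)
    (fun c => glue (GuardState.ofGuard c.state) k c.tapes) (fun c q hq => ?_) le_rfl
  simp only [hq, step_state hq, step_tapes hq]
  exact (step_glue rfl).trans (by rw [act_idle])

theorem iterate_step_glue_main (w : List X) (m : M.Tapes) :
    (guard T M K).step^[K.time w] (glue (Sum.inl (.main K.start)) (K.wordTapes w 0) m) =
      glue (GuardState.ofMain (K.run w (K.time w)).state) (K.run w (K.time w)).tapes m := by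
  rw [← init_tapes]
  refine iterate_step_of_simulates (N := guard T M K)
    (fun c => glue (GuardState.ofMain c.state) c.tapes m) (fun c q hq => ?_) le_rfl
  simp only [hq, step_state hq, step_tapes hq]
  exact (step_glue rfl).trans (by rw [act_idle])

theorem guard_run_of_not_accept {w : List X} (h : ¬ T.accept (T.final w)) :
    ((guard T M K).run w (w.length + (T.translate w).length + 1)).state = Sum.inr false := by
  rw [run_add, guard_run_scan, Function.iterate_one,
    step_glue (by rw [guardTransition_scan_end, if_neg h])]
  rfl

theorem guard_run_of_accept {w : List X} {b : Bool} (h : T.accept (T.final w))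
    (hb : (M.run (T.translate w) (M.time (T.translate w))).state = Sum.inr b) :
    (guard T M K).run w (guardStart T w + M.time (T.translate w)) =
      glue (GuardState.ofGuard (Sum.inr b)) (K.wordTapes w 0)
        (M.run (T.translate w) (M.time (T.translate w))).tapes := by
  rw [run_add, guard_run_guardStart h, iterate_step_glue_guard, hb]

variable {D : Language Y} {E : Language X}

theorem guard_halts_of_notMem (K : TuringMachine X) (hM : M.Decides D) {w : List X}
    (hw : w ∉ T.preimage D) : ∃ t ≤ guardStart T w + M.time (T.translate w),
      ((guard T M K).run w t).state = Sum.inr false := by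
  by_cases ha : T.accept (T.final w)
  · obtain ⟨b, hb, hbD⟩ := hM.exists_state_run_time (T.translate w)
    obtain rfl : b = false := Bool.eq_false_iff.2 fun h => hw ⟨ha, hbD.1 h⟩
    exact ⟨_, le_rfl, congrArg Config.state (guard_run_of_accept ha hb)⟩
  · exact ⟨_, by rw [guardStart]; omega, guard_run_of_not_accept ha⟩

theorem guard_halts_of_mem (hM : M.Decides D) (hK : K.Decides E) {w : List X}
    (hw : w ∈ T.preimage D) : ∃ b : Bool, ((guard T M K).run w
      (guardStart T w + M.time (T.translate w) + K.time w)).state = Sum.inr b ∧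
        (b = true ↔ w ∈ E) := by
  obtain ⟨c, hc, hcD⟩ := hM.exists_state_run_time (T.translate w)
  obtain rfl : c = true := hcD.2 hw.2
  obtain ⟨b, hb, hbE⟩ := hK.exists_state_run_time w
  refine ⟨b, ?_, hbE⟩
  rw [run_add, guard_run_of_accept hw.1 hc]
  exact (congrArg Config.state (iterate_step_glue_main w _)).trans (by rw [hb]; rfl)

theorem guard_decides (hM : M.Decides D) (hK : K.Decides E) :
    (guard T M K).Decides (T.preimage D ⊓ E) := by
  intro w
  by_cases hw : w ∈ T.preimage D
  · obtain ⟨b, hb, hbE⟩ := guard_halts_of_mem hM hK hw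
    exact ⟨_, b, hb, hbE.trans (and_iff_right hw).symm⟩
  · obtain ⟨t, -, ht⟩ := guard_halts_of_notMem K hM hw
    exact ⟨t, false, ht, by simpa using fun h => absurd h hw⟩

open Classical in
theorem guard_time_le (hM : M.Decides D) (hK : K.Decides E) (w : List X) :
    (guard T M K).time w ≤ (2 * T.bound + 2) * (w.length + 1) + M.time (T.translate w) +
      if w ∈ T.preimage D then K.time w else 0 := by
  have hstart := Nat.add_le_add_right (guardStart_le T w) (M.time (T.translate w))
  split_ifs with hw
  · obtain ⟨b, hb, -⟩ := guard_halts_of_mem hM hK hw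
    exact (time_le hb).trans (Nat.add_le_add_right hstart _)
  · obtain ⟨t, ht, hs⟩ := guard_halts_of_notMem K hM hw
    exact (time_le hs).trans (ht.trans hstart)

end Guard

end TuringMachine

/-! ### Schreier rewriting -/

section WordValue

variable {G : Type*} [Group G] {A : Type} (π : A → G)

/-- The group element represented by a single letter. -/
def letterValue (x : A × Bool) : G := if x.2 then π x.1 else (π x.1)⁻¹

theorem wordValue_nil : wordValue π [] = 1 := rfl

theorem wordValue_cons (x : A × Bool) (w : List (A × Bool)) :
    wordValue π (x :: w) = letterValue π x * wordValue π w := by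
  simp only [wordValue, letterValue, List.map_cons, List.prod_cons]

theorem wordValue_append (u v : List (A × Bool)) :
    wordValue π (u ++ v) = wordValue π u * wordValue π v := by
  simp only [wordValue, List.map_append, List.prod_append]

theorem wordValue_eq_lift_mk (w : List (A × Bool)) :
    wordValue π w = FreeGroup.lift π (FreeGroup.mk w) := by
  rw [FreeGroup.lift_mk, wordValue]
  congr! 3 with x
  cases x.2 <;> rfl

variable {π} in
theorem exists_wordValue_eq (hπ : Subgroup.closure (Set.range π) = ⊤) (g : G) :
    ∃ w, wordValue π w = g := by
  obtain ⟨x, rfl⟩ : g ∈ (FreeGroup.lift π).range := by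
    rw [FreeGroup.range_lift_eq_closure, hπ]
    trivial
  induction x using Quot.induction_on with
  | _ w => exact ⟨w, wordValue_eq_lift_mk π w⟩

/-- The membership problem of a subgroup: the language of all words over `A ∪ A⁻¹` that represent
elements of `K`. -/
def membershipProblem (K : Subgroup G) : Language (A × Bool) :=
  {w : List (A × Bool) | wordValue π w ∈ K}

theorem wordProblem_le_membershipProblem (K : Subgroup G) : wordProblem π ≤ membershipProblem π K :=
  fun w (hw : wordValue π w = 1) => show wordValue π w ∈ K from hw ▸ K.one_mem

end WordValue

section Rewriting

variable {G : Type*} [Group G] {H : Subgroup G}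

theorem exists_leftTransversal (H : Subgroup G) [H.FiniteIndex] :
    ∃ (J : Type) (_ : Finite J) (rep : J → G) (o : J), rep o = 1 ∧ (∀ j, rep j ∈ H → j = o) ∧
      ∀ g, ∃ j, ∃ h : H, rep j * h = g := by
  obtain ⟨S, hS, hone⟩ := H.exists_isComplement_left 1
  have : Finite S := hS.finite_left
  have e : S ≃ Fin (Nat.card S) := Finite.equivFin S
  refine ⟨Fin (Nat.card S), inferInstance, fun j => e.symm j, e ⟨1, hone⟩,
    congrArg Subtype.val (e.symm_apply_apply _), fun j hj => ?_, fun g => ?_⟩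
  · have heq := @hS.1 (e.symm j, 1) (⟨1, hone⟩, ⟨_, hj⟩) (by simp)
    exact e.symm_apply_eq.1 (Prod.ext_iff.1 heq).1
  · obtain ⟨⟨s, h⟩, rfl⟩ := hS.2 g
    exact ⟨e s, h, congrArg (fun t : S => (t : G) * h) (e.symm_apply_apply s)⟩

variable {Q : Type*} [Group Q] {A B : Type} {π : A → G} {ρ : B → Q} {φ : H →* Q}

theorem Transducer.exists_wordValue_mul_eq (T : Transducer (A × Bool) (B × Bool))
    {rep : T.State → G} (h : ∀ q x, ∃ h : H, letterValue π x * rep (T.next q x) = rep q * h ∧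
      wordValue ρ (T.output q x) = φ h) (q : T.State) (w : List (A × Bool)) :
    ∃ h : H, wordValue π w * rep (T.finalFrom q w) = rep q * h ∧
      wordValue ρ (T.translateFrom q w) = φ h := by
  induction w generalizing q with
  | nil => exact ⟨1, by simp [wordValue_nil, finalFrom], by simp [wordValue_nil, translateFrom]⟩
  | cons x w ih =>
    obtain ⟨h₁, hrep₁, hout₁⟩ := h q x
    obtain ⟨h₂, hrep₂, hout₂⟩ := ih (T.next q x)
    refine ⟨h₁ * h₂, ?_, ?_⟩
    · change wordValue π (x :: w) * rep (T.finalFrom (T.next q x) w) = _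
      rw [wordValue_cons, mul_assoc, hrep₂, ← mul_assoc, hrep₁, mul_assoc, Subgroup.coe_mul]
    · rw [translateFrom, wordValue_append, hout₁, hout₂, map_mul]

theorem exists_schreierTransducer [Finite A] [H.FiniteIndex] (π : A → G) (φ : H →* Q)
    (hρ : Subgroup.closure (Set.range ρ) = ⊤) :
    ∃ (T : Transducer (A × Bool) (B × Bool)) (rep : T.State → G), rep T.start = 1 ∧
      (∀ q, rep q ∈ H → q = T.start) ∧ T.accept = (· = T.start) ∧
      ∀ q x, ∃ h : H, letterValue π x * rep (T.next q x) = rep q * h ∧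
        wordValue ρ (T.output q x) = φ h := by
  obtain ⟨J, _, rep, o, hone, hmem, hcover⟩ := exists_leftTransversal H
  have hnext : ∀ j x, ∃ j', ∃ h : H, letterValue π x * rep j' = rep j * h := fun j x => by
    obtain ⟨j', h, hj'⟩ := hcover ((letterValue π x)⁻¹ * rep j)
    refine ⟨j', h⁻¹, ?_⟩
    rw [eq_mul_inv_of_mul_eq hj', Subgroup.coe_inv]
    group
  choose next disc hdisc using hnext
  choose out hout using fun j x => exists_wordValue_eq hρ (φ (disc j x))
  obtain ⟨L, hL⟩ := (Set.finite_range fun p : J × A × Bool => (out p.1 p.2).length).bddAbove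
  let T : Transducer (A × Bool) (B × Bool) :=
    { State := J
      finite_state := inferInstance
      start := o
      next := next
      output := out
      bound := L
      length_output_le := fun j x => hL ⟨(j, x), rfl⟩
      accept := (· = o) }
  exact ⟨T, rep, hone, hmem, rfl, fun j x => ⟨disc j x, hdisc j x, hout j x⟩⟩

theorem exists_transducer_preimage_wordProblem [Finite A] [H.FiniteIndex] (π : A → G) (φ : H →* Q)
    (hρ : Subgroup.closure (Set.range ρ) = ⊤) :
    ∃ T : Transducer (A × Bool) (B × Bool),
      T.preimage (wordProblem ρ) = membershipProblem π (φ.ker.map H.subtype) := by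
  obtain ⟨T, rep, hone, hmem, haccept, hT⟩ := exists_schreierTransducer π φ hρ
  refine ⟨T, Set.ext fun w => ?_⟩
  obtain ⟨h, hrep, htranslate⟩ := T.exists_wordValue_mul_eq hT T.start w
  rw [hone, one_mul] at hrep
  change T.accept (T.finalFrom T.start w) ∧ wordValue ρ (T.translateFrom T.start w) = 1 ↔
    wordValue π w ∈ φ.ker.map H.subtype
  rw [htranslate, haccept]
  constructor
  · rintro ⟨hfinal, hh⟩
    rw [hfinal, hone, mul_one] at hrep
    exact ⟨h, hh, hrep.symm⟩
  · rintro ⟨k, hk, hkw : (k : G) = wordValue π w⟩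
    have hfinal : T.finalFrom T.start w = T.start := by
      refine hmem _ ?_
      rw [eq_inv_mul_of_mul_eq hrep, ← hkw]
      exact H.mul_mem (H.inv_mem k.2) h.2
    rw [hfinal, hone, mul_one, ← hkw] at hrep
    exact ⟨hfinal, Subtype.ext hrep ▸ hk⟩

end Rewriting

/-! ### Isoperimetry -/

section Boundary

open scoped Pointwise

variable {G : Type*} [Group G] {V : Type*} [MulAction G V]

open Classical in
/-- The number of edges `v — g • v` of the orbit graph that leave the finite set `F`, counted by
their end points outside `F`. -/
noncomputable def boundaryCard (g : G) (F : Finset V) : ℕ := (g • F \ F).card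

open Classical in
theorem boundaryCard_eq_card_filter (g : G) (F : Finset V) :
    boundaryCard g F = (F.filter fun v => g • v ∉ F).card := by
  rw [boundaryCard, ← Finset.card_smul_finset g (F.filter _)]
  congr 1
  ext v
  simp only [Finset.mem_sdiff, Finset.mem_smul_finset, Finset.mem_filter]
  grind

theorem boundaryCard_one (F : Finset V) : boundaryCard (1 : G) F = 0 := by
  classical
  simp only [boundaryCard, one_smul, sdiff_self, Finset.bot_eq_empty, Finset.card_empty]

theorem boundaryCard_mul_le (g h : G) (F : Finset V) :
    boundaryCard (g * h) F ≤ boundaryCard g F + boundaryCard h F := by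
  classical
  have hsub : (g * h) • F \ F ⊆ g • (h • F \ F) ∪ (g • F \ F) := by
    rw [mul_smul, Finset.smul_finset_sdiff]
    exact sdiff_triangle _ _ _
  refine (Finset.card_le_card hsub).trans ((Finset.card_union_le _ _).trans_eq ?_)
  rw [Finset.card_smul_finset, add_comm, boundaryCard, boundaryCard]

theorem boundaryCard_inv (g : G) (F : Finset V) : boundaryCard g⁻¹ F = boundaryCard g F := by
  classical
  rw [boundaryCard, ← Finset.card_smul_finset g, Finset.smul_finset_sdiff, smul_inv_smul,
    boundaryCard, Finset.card_sdiff_comm (Finset.card_smul_finset g F).symm]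

theorem exists_boundaryCard_le_mul_sum {A : Type*} [Fintype A] {π : A → G}
    (hπ : Subgroup.closure (Set.range π) = ⊤) (g : G) :
    ∃ k : ℕ, ∀ F : Finset V, boundaryCard g F ≤ k * ∑ a, boundaryCard (π a) F := by
  have hg : g ∈ Subgroup.closure (Set.range π) := hπ ▸ Subgroup.mem_top g
  induction hg using Subgroup.closure_induction with
  | mem x hx =>
    obtain ⟨a, rfl⟩ := hx
    refine ⟨1, fun F => ?_⟩
    rw [one_mul]
    exact Finset.single_le_sum (f := fun a => boundaryCard (π a) F) (fun _ _ => Nat.zero_le _)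
      (Finset.mem_univ a)
  | one => exact ⟨0, fun F => by rw [boundaryCard_one, zero_mul]⟩
  | mul x y _ _ hx hy =>
    obtain ⟨k, hk⟩ := hx
    obtain ⟨l, hl⟩ := hy
    refine ⟨k + l, fun F => (boundaryCard_mul_le x y F).trans ?_⟩
    rw [add_mul]
    exact add_le_add (hk F) (hl F)
  | inv x _ hx => simpa only [boundaryCard_inv] using hx

end Boundary

/-- The isoperimetric inequality for the finite family `s` acting on `V`: every finite set has at
least `ε` boundary edges per point. -/
def Isoperimetric {G : Type*} [Group G] {ι : Type*} [Fintype ι] (s : ι → G) (V : Type*)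
    [MulAction G V] (ε : ℝ) : Prop :=
  ∀ F : Finset V, ε * F.card ≤ ∑ i, (boundaryCard (s i) F : ℝ)

namespace Isoperimetric

variable {G : Type*} [Group G] {V : Type*} [MulAction G V] {ι : Type*} [Fintype ι] {ε : ℝ}

theorem exists_of_closure {s : ι → G} (hs : Isoperimetric s V ε) (hε : 0 < ε) {A : Type*}
    [Fintype A] {π : A → G} (hπ : Subgroup.closure (Set.range π) = ⊤) :
    ∃ δ : ℝ, 0 < δ ∧ Isoperimetric π V δ := by
  choose k hk using fun i => exists_boundaryCard_le_mul_sum (V := V) hπ (s i)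
  refine ⟨ε / (∑ i, (k i : ℝ) + 1), by positivity, fun F => ?_⟩
  rw [div_mul_eq_mul_div, div_le_iff₀ (by positivity)]
  calc ε * F.card ≤ ∑ i, (boundaryCard (s i) F : ℝ) := hs F
    _ ≤ ∑ i, (k i : ℝ) * ∑ a, (boundaryCard (π a) F : ℝ) :=
      Finset.sum_le_sum fun i _ => by exact_mod_cast hk i F
    _ = (∑ a, (boundaryCard (π a) F : ℝ)) * ∑ i, (k i : ℝ) := by
      rw [← Finset.sum_mul, mul_comm]
    _ ≤ (∑ a, (boundaryCard (π a) F : ℝ)) * (∑ i, (k i : ℝ) + 1) := by gcongr; linarith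

/-- The points `e (j, x)` of the `j`-th copy of `Q` that lie in `F`. -/
noncomputable def slice {J Q : Type*} (e : J × Q ≃ V) (F : Finset V) (j : J) : Finset Q :=
  F.preimage (fun x => e (j, x)) (e.injective.comp (Prod.mk_right_injective j)).injOn

theorem sum_card_slice {J Q : Type*} [Fintype J] (e : J × Q ≃ V) (F : Finset V) :
    ∑ j, (slice e F j).card = F.card := by
  rw [← Finset.card_sigma]
  refine Finset.card_equiv ((Equiv.sigmaEquivProd J Q).trans e) fun y => ?_
  rw [Finset.mem_sigma, slice, Finset.mem_preimage]
  exact and_iff_right (Finset.mem_univ _)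

theorem boundaryCard_slice_le {J Q : Type*} [Group Q] (e : J × Q ≃ V) {j : J} {g : G} {y : Q}
    (hg : ∀ x, g • e (j, x) = e (j, y * x)) (F : Finset V) :
    boundaryCard y (slice e F j) ≤ boundaryCard g F := by
  classical
  rw [boundaryCard_eq_card_filter, boundaryCard_eq_card_filter]
  refine Finset.card_le_card_of_injOn (fun x => e (j, x)) (fun x hx => ?_)
    (e.injective.comp (Prod.mk_right_injective j)).injOn
  rw [Finset.mem_coe, Finset.mem_filter] at hx ⊢
  simpa only [slice, Finset.mem_preimage, smul_eq_mul, hg] using hx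

theorem of_equiv {J Q : Type*} [Fintype J] [Group Q] {s : ι → Q} (hs : Isoperimetric s Q ε)
    (e : J × Q ≃ V) {t : J → Q → G} (ht : ∀ j y x, t j y • e (j, x) = e (j, y * x)) :
    Isoperimetric (fun y : J × ι => t y.1 (s y.2)) V ε := by
  intro F
  calc ε * F.card = ∑ j, ε * (slice e F j).card := by
        rw [← sum_card_slice e F, Nat.cast_sum, Finset.mul_sum]
    _ ≤ ∑ j, ∑ i, (boundaryCard (s i) (slice e F j) : ℝ) :=
        Finset.sum_le_sum fun j _ => hs (slice e F j)
    _ ≤ ∑ j, ∑ i, (boundaryCard (t j (s i)) F : ℝ) := by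
        gcongr with j _ i _
        exact boundaryCard_slice_le e (ht j (s i)) F
    _ = ∑ y : J × ι, (boundaryCard (t y.1 (s y.2)) F : ℝ) :=
        (Fintype.sum_prod_type fun y : J × ι => (boundaryCard (t y.1 (s y.2)) F : ℝ)).symm

end Isoperimetric

open Classical Pointwise in
theorem card_filter_mul_notMem_inv {G : Type*} [Group G] (g : G) (F : Finset G) :
    (F⁻¹.filter fun x => x * g ∉ F⁻¹).card = boundaryCard g F := by
  rw [← boundaryCard_inv, boundaryCard_eq_card_filter]
  refine Finset.card_equiv (Equiv.inv G) fun x => ?_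
  simp only [Finset.mem_filter, Finset.mem_inv', Equiv.inv_apply, mul_inv_rev, smul_eq_mul]

open Classical Pointwise in
theorem exists_isoperimetric_of_not_isAmenableGroup {G : Type*} [Group G]
    (h : ¬ IsAmenableGroup G) :
    ∃ (S : Finset G) (ε : ℝ), 0 < ε ∧ Isoperimetric (fun s : S => (s : G)) G ε := by
  simp only [IsAmenableGroup, not_forall, not_exists, not_and, not_le] at h
  obtain ⟨S, ε, hε, h⟩ := h
  refine ⟨S, ε, hε, fun F => ?_⟩
  rcases F.eq_empty_or_nonempty with rfl | hF
  · rw [Finset.card_empty, Nat.cast_zero, mul_zero]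
    positivity
  obtain ⟨s, hs, hlt⟩ := h F⁻¹ hF.inv
  rw [card_filter_mul_notMem_inv, Finset.card_inv] at hlt
  have hle := Finset.single_le_sum (f := fun s : S => (boundaryCard (s : G) F : ℝ))
    (fun _ _ => Nat.cast_nonneg _) (Finset.mem_univ ⟨s, hs⟩)
  exact hlt.le.trans hle

section Cosets

variable {G : Type*} [Group G] {H : Subgroup G} {Q : Type*} [Group Q] {φ : H →* Q}

/-- The cosets of the kernel of a homomorphism from `H` onto `Q` form a union of copies of `Q`
indexed by the cosets of `H`. -/
noncomputable def quotientProdEquiv (hφ : Function.Surjective φ) :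
    (G ⧸ H) × Q ≃ G ⧸ φ.ker.map H.subtype :=
  ((Subgroup.quotientEquivProdOfLE (Subgroup.map_subtype_le φ.ker)).trans
    (Equiv.prodCongrRight fun _ =>
      (Subgroup.quotientEquivOfEq (Subgroup.comap_map_eq_self_of_injective
        H.subtype_injective φ.ker)).trans
        (QuotientGroup.quotientKerEquivOfSurjective φ hφ).toEquiv)).symm

theorem quotientProdEquiv_apply (hφ : Function.Surjective φ) (q : G ⧸ H) (h : H) :
    quotientProdEquiv hφ (q, φ h) = ((q.out * h : G) : G ⧸ φ.ker.map H.subtype) := by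
  have hsymm : (QuotientGroup.quotientKerEquivOfSurjective φ hφ).symm (φ h) = (h : H ⧸ φ.ker) :=
    (MulEquiv.symm_apply_eq _).2 rfl
  exact congrArg (fun c => (Subgroup.quotientEquivProdOfLE (Subgroup.map_subtype_le φ.ker)).symm
    (q, (Subgroup.quotientEquivOfEq (Subgroup.comap_map_eq_self_of_injective
      H.subtype_injective φ.ker)).symm c)) hsymm

theorem exists_smul_quotientProdEquiv (hφ : Function.Surjective φ) (q : G ⧸ H) (y : Q) :
    ∃ g : G, ∀ x, g • quotientProdEquiv hφ (q, x) = quotientProdEquiv hφ (q, y * x) := by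
  obtain ⟨k, rfl⟩ := hφ y
  refine ⟨q.out * k * q.out⁻¹, fun x => ?_⟩
  obtain ⟨h, rfl⟩ := hφ x
  rw [← map_mul, quotientProdEquiv_apply, quotientProdEquiv_apply]
  change ((q.out * k * q.out⁻¹ * (q.out * h) : G) : G ⧸ φ.ker.map H.subtype) = _
  rw [Subgroup.coe_mul, mul_assoc, inv_mul_cancel_left, mul_assoc]

theorem exists_isoperimetric_quotient [H.FiniteIndex] (hφ : Function.Surjective φ)
    (hQ : ¬ IsAmenableGroup Q) {A : Type*} [Fintype A] {π : A → G}
    (hπ : Subgroup.closure (Set.range π) = ⊤) :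
    ∃ ε : ℝ, 0 < ε ∧ Isoperimetric π (G ⧸ φ.ker.map H.subtype) ε := by
  have : Fintype (G ⧸ H) := Fintype.ofFinite _
  obtain ⟨S, ε, hε, hS⟩ := exists_isoperimetric_of_not_isAmenableGroup hQ
  choose t ht using exists_smul_quotientProdEquiv (G := G) hφ
  exact (hS.of_equiv (quotientProdEquiv hφ) ht).exists_of_closure hε hπ

end Cosets

/-! ### The spectral gap -/

section Coarea

open MeasureTheory

variable {G : Type*} [Group G] {V : Type*} [MulAction G V] {ι : Type*} [Fintype ι] {s : ι → G}
  {ε : ℝ}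

theorem integral_indicator_Ico_one (a b : ℝ) :
    ∫ t, (Set.Ico a b).indicator (fun _ => (1 : ℝ)) t = max (b - a) 0 := by
  rw [integral_indicator_const _ measurableSet_Ico, Real.volume_real_Ico, smul_eq_mul, mul_one]

theorem integrable_indicator_Ico_one (a b : ℝ) :
    Integrable ((Set.Ico a b).indicator fun _ => (1 : ℝ)) :=
  IntegrableOn.integrable_indicator (integrableOn_const measure_Ico_lt_top.ne) measurableSet_Ico

theorem Isoperimetric.sum_indicator_Ico_le (hs : Isoperimetric s V ε) {F : Finset V} {f : V → ℝ}
    (hF : ∀ v ∉ F, f v = 0) (t : ℝ) :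
    ε * ∑ v ∈ F, (Set.Ico 0 (f v)).indicator (fun _ => (1 : ℝ)) t ≤
      ∑ i, ∑ v ∈ F, (Set.Ico (f (s i • v)) (f v)).indicator (fun _ => (1 : ℝ)) t := by
  classical
  rcases lt_or_ge t 0 with ht | ht
  · have hzero : ∀ v, (Set.Ico 0 (f v)).indicator (fun _ => (1 : ℝ)) t = 0 := fun v =>
      Set.indicator_of_notMem (fun h => ht.not_ge h.1) _
    simp only [hzero, Finset.sum_const_zero, mul_zero]
    exact Finset.sum_nonneg fun i _ => Finset.sum_nonneg fun v _ =>
      Set.indicator_nonneg (fun _ _ => zero_le_one) _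
  have hmem : ∀ v, v ∈ F.filter (fun v => t < f v) ↔ t < f v := fun v => by
    rw [Finset.mem_filter, and_iff_right_iff_imp]
    exact fun h => by_contra fun hv => (hF v hv ▸ h).not_ge ht
  convert hs (F.filter fun v => t < f v) with i
  · rw [Finset.card_filter, Nat.cast_sum]
    refine Finset.sum_congr rfl fun v _ => ?_
    simp only [Set.indicator_apply, Set.mem_Ico, ht, true_and, Nat.cast_ite, Nat.cast_one,
      Nat.cast_zero]
  · rw [boundaryCard_eq_card_filter, Finset.filter_filter, Finset.card_filter, Nat.cast_sum]
    refine Finset.sum_congr rfl fun v _ => ?_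
    simp only [Set.indicator_apply, Set.mem_Ico, hmem, not_lt, and_comm, Nat.cast_ite, Nat.cast_one,
      Nat.cast_zero]

theorem Isoperimetric.sum_le_sum_max_sub (hs : Isoperimetric s V ε) {F : Finset V} {f : V → ℝ}
    (hf : 0 ≤ f) (hF : ∀ v ∉ F, f v = 0) :
    ε * ∑ v ∈ F, f v ≤ ∑ i, ∑ v ∈ F, max (f v - f (s i • v)) 0 := by
  -- Integrate the isoperimetric inequality over the level sets of `f`.
  have hmono := integral_mono
    ((integrable_finsetSum F fun v _ => integrable_indicator_Ico_one 0 (f v)).const_mul ε)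
    (integrable_finsetSum Finset.univ fun i _ => integrable_finsetSum F fun v _ =>
      integrable_indicator_Ico_one (f (s i • v)) (f v))
    (hs.sum_indicator_Ico_le hF)
  have hlevel : ∀ v, max (f v) 0 = f v := fun v => max_eq_left (hf v)
  rw [integral_const_mul, integral_finsetSum _ fun _ _ => integrable_indicator_Ico_one _ _,
    integral_finsetSum _ fun _ _ => integrable_finsetSum F fun _ _ =>
      integrable_indicator_Ico_one _ _] at hmono
  simpa only [integral_finsetSum F fun _ _ => integrable_indicator_Ico_one _ _,
    integral_indicator_Ico_one, sub_zero, hlevel] using hmono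

end Coarea

section Dot

variable {V : Type*}

/-- The standard scalar product on finitely supported functions. -/
noncomputable def finsuppDot (V : Type*) : (V →₀ ℝ) →ₗ[ℝ] (V →₀ ℝ) →ₗ[ℝ] ℝ :=
  Finsupp.bilinearCombination ℝ ℝ ∘ₗ Finsupp.lcoeFun

theorem finsuppDot_eq_sum (f : V →₀ ℝ) {g : V →₀ ℝ} {F : Finset V} (h : g.support ⊆ F) :
    finsuppDot V f g = ∑ v ∈ F, f v * g v := by
  refine (Finsupp.sum_of_support_subset g h (fun v a => a • f v) fun _ _ => zero_smul ..).trans ?_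
  exact Finset.sum_congr rfl fun _ _ => mul_comm _ _

theorem finsuppDot_comm (f g : V →₀ ℝ) : finsuppDot V f g = finsuppDot V g f := by
  classical
  rw [finsuppDot_eq_sum f (F := f.support ∪ g.support) Finset.subset_union_right,
    finsuppDot_eq_sum g (F := f.support ∪ g.support) Finset.subset_union_left]
  exact Finset.sum_congr rfl fun _ _ => mul_comm _ _

theorem sum_sq_le_finsuppDot (f : V →₀ ℝ) (F : Finset V) :
    ∑ v ∈ F, f v ^ 2 ≤ finsuppDot V f f := by
  classical
  rw [finsuppDot_eq_sum f (F := f.support ∪ F) Finset.subset_union_left]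
  simp only [← pow_two]
  exact Finset.sum_le_sum_of_subset_of_nonneg Finset.subset_union_right fun _ _ _ => sq_nonneg _

theorem finsuppDot_mapRange_abs (f : V →₀ ℝ) :
    finsuppDot V (f.mapRange abs abs_zero) (f.mapRange abs abs_zero) = finsuppDot V f f := by
  rw [finsuppDot_eq_sum f le_rfl, finsuppDot_eq_sum _ Finsupp.support_mapRange]
  simp only [Finsupp.mapRange_apply, abs_mul_abs_self]

end Dot

section Walk

variable {G : Type*} [Group G] {V : Type*} [MulAction G V] {ι : Type*} [Fintype ι]

/-- The action of a group element on finitely supported functions. -/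
noncomputable def translation (V : Type*) [MulAction G V] (g : G) : (V →₀ ℝ) →ₗ[ℝ] (V →₀ ℝ) :=
  (Finsupp.domLCongr (MulAction.toPerm g)).toLinearMap

theorem translation_apply (g : G) (f : V →₀ ℝ) (v : V) : translation V g f v = f (g⁻¹ • v) := rfl

theorem translation_single (g : G) (v : V) (a : ℝ) :
    translation V g (Finsupp.single v a) = Finsupp.single (g • v) a := by
  rw [translation, LinearEquiv.coe_coe, Finsupp.domLCongr_single, MulAction.toPerm_apply]

theorem finsuppDot_translation_left (g : G) (f h : V →₀ ℝ) :
    finsuppDot V (translation V g f) h = finsuppDot V f (translation V g⁻¹ h) := by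
  rw [finsuppDot_eq_sum _ le_rfl,
    finsuppDot_eq_sum (F := h.support.map (MulAction.toPerm g⁻¹).toEmbedding) f]
  · rw [Finset.sum_map]
    refine Finset.sum_congr rfl fun v _ => ?_
    simp [translation_apply]
  · intro v hv
    rw [Finsupp.mem_support_iff, translation_apply, inv_inv] at hv
    exact Finset.mem_map.2 ⟨g • v, Finsupp.mem_support_iff.2 hv, inv_smul_smul g v⟩

/-- The sum of the translations by the members of the family `s`. -/
noncomputable def walkOperator (s : ι → G) (V : Type*) [MulAction G V] :
    (V →₀ ℝ) →ₗ[ℝ] (V →₀ ℝ) := ∑ i, translation V (s i)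

theorem finsuppDot_walkOperator (s : ι → G) (f h : V →₀ ℝ) :
    finsuppDot V (walkOperator s V f) h = ∑ i, finsuppDot V f (translation V (s i)⁻¹ h) := by
  simp only [walkOperator, LinearMap.sum_apply, map_sum, finsuppDot_translation_left]

theorem abs_finsuppDot_walkOperator_le (s : ι → G) (f : V →₀ ℝ) :
    |finsuppDot V (walkOperator s V f) f| ≤
      finsuppDot V (walkOperator s V (f.mapRange abs abs_zero)) (f.mapRange abs abs_zero) := by
  rw [finsuppDot_eq_sum _ le_rfl, finsuppDot_eq_sum _ Finsupp.support_mapRange]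
  refine (Finset.abs_sum_le_sum_abs _ _).trans (Finset.sum_le_sum fun v _ => ?_)
  simp only [walkOperator, LinearMap.sum_apply, Finsupp.finsetSum_apply, translation_apply,
    Finsupp.mapRange_apply, abs_mul]
  gcongr
  exact Finset.abs_sum_le_sum_abs _ _

theorem max_sq_sub_sq_le {c : ℝ} (hc : 0 < c) (x y : ℝ) :
    max (x ^ 2 - y ^ 2) 0 ≤ c * x ^ 2 + c⁻¹ * (x - y) ^ 2 := by
  have hsq : 0 ≤ c⁻¹ * (c * x - (x - y)) ^ 2 := by positivity
  have hexpand :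
      c⁻¹ * (c * x - (x - y)) ^ 2 = c * x ^ 2 - 2 * x * (x - y) + c⁻¹ * (x - y) ^ 2 := by
    field_simp
    ring
  exact max_le (by linarith [sq_nonneg (x - y)]) (by positivity)

theorem sum_sq_sub_le (g : G) (f : V →₀ ℝ) :
    ∑ v ∈ f.support, (f v - f (g • v)) ^ 2 ≤
      2 * (finsuppDot V f f - finsuppDot V f (translation V g⁻¹ f)) := by
  have hshift : ∑ v ∈ f.support, f (g • v) ^ 2 ≤ finsuppDot V f f :=
    (Finset.sum_map f.support (MulAction.toPerm g).toEmbedding fun v => f v ^ 2).symm.trans_le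
      (sum_sq_le_finsuppDot f _)
  have hself : finsuppDot V f f = ∑ v ∈ f.support, f v ^ 2 := by
    simp only [finsuppDot_eq_sum f le_rfl, pow_two]
  have hcross : finsuppDot V f (translation V g⁻¹ f) = ∑ v ∈ f.support, f v * f (g • v) := by
    rw [finsuppDot_comm, finsuppDot_eq_sum _ le_rfl]
    refine Finset.sum_congr rfl fun v _ => ?_
    rw [translation_apply, inv_inv, mul_comm]
  calc ∑ v ∈ f.support, (f v - f (g • v)) ^ 2
      = ∑ v ∈ f.support, f v ^ 2 + ∑ v ∈ f.support, f (g • v) ^ 2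
        - 2 * ∑ v ∈ f.support, f v * f (g • v) := by
        rw [Finset.mul_sum, ← Finset.sum_add_distrib, ← Finset.sum_sub_distrib]
        exact Finset.sum_congr rfl fun v _ => by ring
    _ ≤ 2 * (finsuppDot V f f - finsuppDot V f (translation V g⁻¹ f)) := by
        rw [hcross]
        linarith

namespace Isoperimetric

variable {s : ι → G} {ε : ℝ}

theorem mul_finsuppDot_le (hs : Isoperimetric s V ε) {c : ℝ} (hc : 0 < c) (f : V →₀ ℝ) :
    ε * finsuppDot V f f ≤ c * (Fintype.card ι * finsuppDot V f f) +
      c⁻¹ * (2 * (Fintype.card ι * finsuppDot V f f - finsuppDot V (walkOperator s V f) f)) := by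
  have hself : finsuppDot V f f = ∑ v ∈ f.support, f v ^ 2 := by
    simp only [finsuppDot_eq_sum f le_rfl, pow_two]
  have hzero : ∀ v ∉ f.support, f v ^ 2 = 0 := fun v hv => by
    rw [Finsupp.notMem_support_iff.1 hv, zero_pow two_ne_zero]
  calc ε * finsuppDot V f f = ε * ∑ v ∈ f.support, f v ^ 2 := by rw [hself]
    _ ≤ ∑ i, ∑ v ∈ f.support, max (f v ^ 2 - f (s i • v) ^ 2) 0 :=
        hs.sum_le_sum_max_sub (fun v => sq_nonneg (f v)) hzero
    _ ≤ ∑ i, ∑ v ∈ f.support, (c * f v ^ 2 + c⁻¹ * (f v - f (s i • v)) ^ 2) := by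
        gcongr
        exact max_sq_sub_sq_le hc _ _
    _ = ∑ i, (c * finsuppDot V f f + c⁻¹ * ∑ v ∈ f.support, (f v - f (s i • v)) ^ 2) := by
        simp only [Finset.sum_add_distrib, Finset.mul_sum, hself]
    _ ≤ ∑ i, (c * finsuppDot V f f +
          c⁻¹ * (2 * (finsuppDot V f f - finsuppDot V f (translation V (s i)⁻¹ f)))) := by
        gcongr
        exact sum_sq_sub_le _ _
    _ = _ := by
        rw [finsuppDot_walkOperator, Finset.sum_add_distrib, Finset.sum_const, Finset.card_univ,
          ← Finset.mul_sum, ← Finset.mul_sum, Finset.sum_sub_distrib, Finset.sum_const,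
          Finset.card_univ]
        simp only [nsmul_eq_mul]
        ring

theorem finsuppDot_walkOperator_le [Nonempty ι] (hs : Isoperimetric s V ε) (hε : 0 < ε)
    (f : V →₀ ℝ) :
    finsuppDot V (walkOperator s V f) f ≤
      (Fintype.card ι - ε ^ 2 / (8 * Fintype.card ι)) * finsuppDot V f f := by
  have hk : (0 : ℝ) < Fintype.card ι := Nat.cast_pos.2 Fintype.card_pos
  have h := hs.mul_finsuppDot_le (c := ε / (2 * Fintype.card ι)) (by positivity) f
  generalize (Fintype.card ι : ℝ) = k at *
  generalize finsuppDot V f f = N at *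
  generalize finsuppDot V (walkOperator s V f) f = B at *
  have hgap : ε / 2 * N ≤ 4 * k / ε * (k * N - B) := by
    have hc : ε / (2 * k) * (k * N) + (ε / (2 * k))⁻¹ * (2 * (k * N - B)) =
        ε / 2 * N + 4 * k / ε * (k * N - B) := by
      field_simp
      ring
    linarith
  rw [div_mul_eq_mul_div (4 * k), le_div_iff₀ hε] at hgap
  rw [sub_mul, le_sub_comm, div_mul_eq_mul_div, div_le_iff₀ (by positivity)]
  linarith

theorem exists_abs_finsuppDot_walkOperator_le [Nonempty ι] (hs : Isoperimetric s V ε)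
    (hε : 0 < ε) :
    ∃ r : ℝ, 0 < r ∧ r < 1 ∧ ∀ f : V →₀ ℝ,
      |finsuppDot V (walkOperator s V f) f| ≤ r * Fintype.card ι * finsuppDot V f f := by
  have : (0 : ℝ) < Fintype.card ι := Nat.cast_pos.2 Fintype.card_pos
  refine ⟨max (1 - ε ^ 2 / (8 * Fintype.card ι ^ 2)) (1 / 2), by positivity,
    max_lt (sub_lt_self _ (by positivity)) (by norm_num), fun f => ?_⟩
  have hnonneg : 0 ≤ finsuppDot V f f := sum_sq_le_finsuppDot f ∅
  calc |finsuppDot V (walkOperator s V f) f|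
      ≤ (Fintype.card ι - ε ^ 2 / (8 * Fintype.card ι)) * finsuppDot V f f := by
        rw [← finsuppDot_mapRange_abs]
        exact (abs_finsuppDot_walkOperator_le s f).trans (hs.finsuppDot_walkOperator_le hε _)
    _ = (1 - ε ^ 2 / (8 * Fintype.card ι ^ 2)) * Fintype.card ι * finsuppDot V f f := by
        field_simp
    _ ≤ max (1 - ε ^ 2 / (8 * Fintype.card ι ^ 2)) (1 / 2) * Fintype.card ι *
          finsuppDot V f f := by
        gcongr
        exact le_max_left _ _

theorem nonempty_index [Nonempty V] (hs : Isoperimetric s V ε) (hε : 0 < ε) : Nonempty ι := by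
  by_contra h
  rw [not_nonempty_iff] at h
  obtain ⟨v⟩ := ‹Nonempty V›
  have hv := hs {v}
  rw [Finset.card_singleton, Nat.cast_one, mul_one, Fintype.sum_empty] at hv
  exact hv.not_gt hε

end Isoperimetric

end Walk

section NumericalRadius

variable {E : Type*} [AddCommGroup E] [Module ℝ E] {B : E →ₗ[ℝ] E →ₗ[ℝ] ℝ} {P : E →ₗ[ℝ] E} {r : ℝ}

theorem apply_map_map_le_of_abs_le (hP : ∀ f g, B (P f) g = B f (P g)) (hr : 0 < r)
    (h : ∀ f, |B (P f) f| ≤ r * B f f) (f : E) : B (P f) (P f) ≤ r ^ 2 * B f f := by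
  -- Compare the bounds at `r • f + P f` and `r • f - P f`.
  have hadd := (abs_le.1 (h (r • f + P f))).2
  have hsub := (abs_le.1 (h (r • f - P f))).1
  simp only [map_add, map_sub, map_smul, LinearMap.add_apply, LinearMap.sub_apply,
    LinearMap.smul_apply, smul_eq_mul, hP (P f) f, ← hP f f] at hadd hsub
  have hmul : r * (4 * B (P f) (P f)) ≤ r * (2 * (r ^ 2 * B f f + B (P f) (P f))) := by linarith
  linarith [le_of_mul_le_mul_left hmul hr]

theorem apply_pow_pow_le_of_abs_le (hP : ∀ f g, B (P f) g = B f (P g)) (hr : 0 < r)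
    (h : ∀ f, |B (P f) f| ≤ r * B f f) (f : E) (n : ℕ) :
    B ((P ^ n) f) ((P ^ n) f) ≤ (r ^ n) ^ 2 * B f f := by
  induction n with
  | zero => simp only [pow_zero, Module.End.one_apply, one_pow, one_mul, le_rfl]
  | succ n ih =>
    rw [pow_succ', Module.End.mul_apply]
    calc B (P ((P ^ n) f)) (P ((P ^ n) f)) ≤ r ^ 2 * B ((P ^ n) f) ((P ^ n) f) :=
          apply_map_map_le_of_abs_le hP hr h _
      _ ≤ r ^ 2 * ((r ^ n) ^ 2 * B f f) := by gcongr
      _ = (r ^ (n + 1)) ^ 2 * B f f := by ring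

end NumericalRadius

/-! ### Exponentially negligible languages -/

section Words

variable {X : Type}

/-- The words of length `n`. -/
noncomputable def wordsOfLength (X : Type) [Finite X] (n : ℕ) : Finset (List X) :=
  (List.finite_length_eq X n).toFinset

theorem mem_wordsOfLength [Finite X] {n : ℕ} {w : List X} :
    w ∈ wordsOfLength X n ↔ w.length = n :=
  Set.Finite.mem_toFinset _

theorem wordsOfLength_zero (X : Type) [Finite X] : wordsOfLength X 0 = {[]} := by
  ext w
  rw [mem_wordsOfLength, List.length_eq_zero_iff, Finset.mem_singleton]

theorem sum_wordsOfLength_succ [Fintype X] {M : Type*} [AddCommMonoid M] (n : ℕ)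
    (f : List X → M) :
    ∑ w ∈ wordsOfLength X (n + 1), f w = ∑ x, ∑ w ∈ wordsOfLength X n, f (x :: w) := by
  rw [← Finset.sum_product']
  have hinj : Function.Injective fun p : X × List X => p.1 :: p.2 :=
    fun (p q : X × List X) h => Prod.ext_iff.2 (List.cons_eq_cons.1 h)
  refine (Finset.sum_nbij (fun p : X × List X => p.1 :: p.2) (fun p hp => ?_) hinj.injOn
    (fun w hw => ?_) fun _ _ => rfl).symm
  · rw [Finset.mem_product, mem_wordsOfLength] at hp
    rw [mem_wordsOfLength, List.length_cons, hp.2]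
  · rw [Finset.mem_coe, mem_wordsOfLength] at hw
    obtain ⟨x, w, rfl⟩ := List.exists_cons_of_length_eq_add_one hw
    exact ⟨(x, w), Finset.mem_product.2 ⟨Finset.mem_univ x,
      mem_wordsOfLength.2 (Nat.succ_injective hw)⟩, rfl⟩

theorem card_wordsOfLength (X : Type) [Fintype X] (n : ℕ) :
    (wordsOfLength X n).card = Fintype.card X ^ n := by
  induction n with
  | zero => rw [wordsOfLength_zero, Finset.card_singleton, pow_zero]
  | succ n ih =>
    rw [Finset.card_eq_sum_ones, sum_wordsOfLength_succ, ← Finset.card_eq_sum_ones, ih,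
      Finset.sum_const, Finset.card_univ, smul_eq_mul, pow_succ']

open Classical in
/-- The proportion of the words of length `n` that lie in `D` decays exponentially in `n`. -/
def IsExponentiallyNegligible [Finite X] (D : Language X) : Prop :=
  ∃ r : ℝ, 0 < r ∧ r < 1 ∧ ∀ n,
    (((wordsOfLength X n).filter (· ∈ D)).card : ℝ) ≤ r ^ n * (wordsOfLength X n).card

end Words

section ReturnWords

variable {G : Type*} [Group G] {V : Type*} [MulAction G V] {A : Type} [Fintype A] {π : A → G}
  {ε : ℝ}

theorem walkOperator_pow_single (π : A → G) (v : V) (n : ℕ) :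
    ((walkOperator (letterValue π) V) ^ n) (Finsupp.single v 1) =
      ∑ w ∈ wordsOfLength (A × Bool) n, Finsupp.single (wordValue π w • v) (1 : ℝ) := by
  induction n with
  | zero =>
    rw [wordsOfLength_zero, Finset.sum_singleton, wordValue_nil, one_smul, pow_zero,
      Module.End.one_apply]
  | succ n ih =>
    rw [pow_succ', Module.End.mul_apply, ih, sum_wordsOfLength_succ]
    simp only [walkOperator, LinearMap.sum_apply, map_sum, translation_single, wordValue_cons,
      mul_smul]
    exact Finset.sum_comm

open Classical in
theorem walkOperator_pow_single_apply_self (π : A → G) (v : V) (n : ℕ) :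
    ((walkOperator (letterValue π) V) ^ n) (Finsupp.single v 1) v =
      ((wordsOfLength (A × Bool) n).filter fun w => wordValue π w • v = v).card := by
  rw [walkOperator_pow_single, Finsupp.finsetSum_apply, Finset.card_filter, Nat.cast_sum]
  exact Finset.sum_congr rfl fun w _ => by rw [Finsupp.single_apply, Nat.cast_ite, Nat.cast_one,
    Nat.cast_zero]

theorem finsuppDot_walkOperator_letterValue (π : A → G) (f h : V →₀ ℝ) :
    finsuppDot V (walkOperator (letterValue π) V f) h =
      finsuppDot V f (walkOperator (letterValue π) V h) := by
  rw [finsuppDot_walkOperator]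
  simp only [walkOperator, LinearMap.sum_apply, map_sum]
  refine Fintype.sum_equiv ((Equiv.refl A).prodCongr Equiv.boolNot) _ _ ?_
  rintro ⟨a, b⟩
  cases b <;> simp [letterValue]

namespace Isoperimetric

theorem symmetrize (h : Isoperimetric π V ε) : Isoperimetric (letterValue π) V ε := fun F => by
  refine (h F).trans ?_
  rw [Fintype.sum_prod_type]
  refine Finset.sum_le_sum fun a _ => ?_
  rw [Fintype.sum_bool]
  exact le_add_of_nonneg_right (Nat.cast_nonneg _)

theorem isExponentiallyNegligible_stabilizer (hπ : Isoperimetric π V ε) (hε : 0 < ε) (v : V) :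
    IsExponentiallyNegligible (membershipProblem π (MulAction.stabilizer G v)) := by
  have : Nonempty V := ⟨v⟩
  have := hπ.symmetrize.nonempty_index hε
  obtain ⟨r, hr, hr1, h⟩ := hπ.symmetrize.exists_abs_finsuppDot_walkOperator_le hε
  refine ⟨r, hr, hr1, fun n => ?_⟩
  rw [card_wordsOfLength, Nat.cast_pow, ← mul_pow]
  refine le_of_sq_le_sq ?_ (by positivity)
  set f := ((walkOperator (letterValue π) V) ^ n) (Finsupp.single v 1)
  calc _ = ∑ u ∈ {v}, f u ^ 2 := by
        rw [Finset.sum_singleton, walkOperator_pow_single_apply_self]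
        rfl
    _ ≤ finsuppDot V f f := sum_sq_le_finsuppDot _ _
    _ ≤ ((r * Fintype.card (A × Bool)) ^ n) ^ 2 *
          finsuppDot V (Finsupp.single v 1) (Finsupp.single v 1) :=
        apply_pow_pow_le_of_abs_le (finsuppDot_walkOperator_letterValue π) (by positivity) h _ n
    _ = ((r * Fintype.card (A × Bool)) ^ n) ^ 2 := by
        rw [finsuppDot_eq_sum _ Finsupp.support_single_subset, Finset.sum_singleton,
          Finsupp.single_eq_same, one_mul, mul_one]

end Isoperimetric

end ReturnWords

theorem isExponentiallyNegligible_membershipProblem_map_ker {G : Type*} [Group G] {H : Subgroup G}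
    [H.FiniteIndex] {Q : Type*} [Group Q] {φ : H →* Q} (hφ : Function.Surjective φ)
    (hQ : ¬ IsAmenableGroup Q) {A : Type} [Finite A] {π : A → G}
    (hπ : Subgroup.closure (Set.range π) = ⊤) :
    IsExponentiallyNegligible (membershipProblem π (φ.ker.map H.subtype)) := by
  have := Fintype.ofFinite A
  obtain ⟨ε, hε, h⟩ := exists_isoperimetric_quotient hφ hQ hπ
  rw [← MulAction.stabilizer_quotient (φ.ker.map H.subtype)]
  exact h.isExponentiallyNegligible_stabilizer hε _

/-! ### Subexponential functions -/

namespace Subexponential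

variable {f g : ℕ → ℕ}

theorem exists_le_mul_pow (hf : Subexponential f) {s : ℝ} (hs : 1 < s) :
    ∃ R : ℝ≥0, ∀ n, (f n : ℝ) ≤ R * s ^ n := by
  obtain ⟨R, hR⟩ := (hf s hs).bddAbove_range
  refine ⟨R.toNNReal, fun n => ?_⟩
  rw [← div_le_iff₀ (by positivity)]
  exact (hR (Set.mem_range_self n)).trans (Real.le_coe_toNNReal R)

theorem of_forall_exists_le_mul_pow
    (hf : ∀ s : ℝ, 1 < s → ∃ R : ℝ≥0, ∀ n, (f n : ℝ) ≤ R * s ^ n) : Subexponential f := by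
  intro r hr
  obtain ⟨s, hs, hsr⟩ := exists_between hr
  obtain ⟨R, hR⟩ := hf s hs
  have : 0 < s := zero_lt_one.trans hs
  have hr₀ : 0 < r := zero_lt_one.trans hr
  have hlim : Filter.Tendsto (fun n : ℕ => (R : ℝ) * (s / r) ^ n) Filter.atTop (𝓝 0) := by
    simpa only [mul_zero] using (tendsto_pow_atTop_nhds_zero_of_lt_one (by positivity)
      ((div_lt_one hr₀).2 hsr)).const_mul (R : ℝ)
  refine squeeze_zero (fun n => by positivity) (fun n => ?_) hlim
  rw [div_pow, ← mul_div_assoc]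
  gcongr
  exact hR n

theorem add (hf : Subexponential f) (hg : Subexponential g) :
    Subexponential fun n => f n + g n := fun r hr => by
  simpa only [Nat.cast_add, add_div, add_zero] using (hf r hr).add (hg r hr)

theorem linear (a : ℕ) : Subexponential fun n => a * (n + 1) := fun r hr => by
  have h := ((tendsto_pow_const_div_const_pow_of_one_lt 1 hr).add
    (tendsto_pow_const_div_const_pow_of_one_lt 0 hr)).const_mul (a : ℝ)
  simpa only [pow_one, pow_zero, add_zero, mul_zero, ← add_div, ← mul_div_assoc, Nat.cast_mul,
    Nat.cast_add, Nat.cast_one] using h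

theorem sup_range_mul (hf : Subexponential f) (b : ℕ) :
    Subexponential fun n => (Finset.range (b * n + 1)).sup f := by
  refine of_forall_exists_le_mul_pow fun s hs => ?_
  set t : ℝ := s ^ (((b + 1 : ℕ) : ℝ)⁻¹)
  have ht : 1 < t := Real.one_lt_rpow hs (by positivity)
  have hts : t ^ (b + 1) = s := Real.rpow_inv_natCast_pow (by positivity) b.succ_ne_zero
  obtain ⟨R, hR⟩ := hf.exists_le_mul_pow ht
  refine ⟨R, fun n => ?_⟩
  obtain ⟨i, hi, hsup⟩ := Finset.exists_mem_eq_sup (Finset.range (b * n + 1))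
    Finset.nonempty_range_add_one f
  have hin : i ≤ (b + 1) * n :=
    (Finset.mem_range_succ_iff.1 hi).trans (Nat.mul_le_mul_right n b.le_succ)
  calc (((Finset.range (b * n + 1)).sup f : ℕ) : ℝ) = f i := by rw [hsup]
    _ ≤ R * t ^ i := hR i
    _ ≤ R * t ^ ((b + 1) * n) := by gcongr; exact ht.le
    _ = R * s ^ n := by rw [pow_mul, hts]

end Subexponential

theorem Transducer.preimage_mem_subExp {X Y : Type} [Finite X] [Finite Y] (T : Transducer X Y)
    {E : Language Y} (hE : E ∈ SubExp Y) : T.preimage E ∈ SubExp X := by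
  obtain ⟨f, hf, M, hM, hMf⟩ := hE
  obtain ⟨hK, hKt⟩ := TuringMachine.acceptAll_decidesInTime X
  refine ⟨_, (Subexponential.linear (2 * T.bound + 3)).add (hf.sup_range_mul T.bound),
    .guard T M (.acceptAll X), inf_top_eq (T.preimage E) ▸ TuringMachine.guard_decides hM hK,
    fun w => (TuringMachine.guard_time_le hM hK w).trans ?_⟩
  have hle : M.time (T.translate w) ≤ (Finset.range (T.bound * w.length + 1)).sup f :=
    (hMf _).trans (Finset.le_sup (Finset.mem_range_succ_iff.2 (T.length_translateFrom_le _ w)))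
  have := hKt w
  split_ifs <;> lia

theorem WordProblemIn.wordProblem_mem_subExp {G : Type*} [Group G] (hG : WordProblemIn G SubExp)
    {A : Type} [Finite A] (π : A → G) : wordProblem π ∈ SubExp (A × Bool) := by
  obtain ⟨B, _, ρ, hρ, hE⟩ := hG
  obtain ⟨T, hT⟩ :=
    exists_transducer_preimage_wordProblem π (Subgroup.topEquiv (G := G)).toMonoidHom hρ
  have hker : (Subgroup.topEquiv (G := G)).toMonoidHom.ker.map (⊤ : Subgroup G).subtype = ⊥ := by
    rw [(MonoidHom.ker_eq_bot_iff _).2 (Subgroup.topEquiv (G := G)).injective, Subgroup.map_bot]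
  have hbot : membershipProblem π (⊥ : Subgroup G) = wordProblem π :=
    Set.ext fun _ => Subgroup.mem_bot
  rw [hker, hbot] at hT
  exact hT ▸ T.preimage_mem_subExp hE

theorem TimeClass.exists_linear_add_comp_mul_le (𝒞 : TimeClass) {f : ℕ → ℕ} (hf : f ∈ 𝒞.bounds)
    (a b : ℕ) :
    ∃ g ∈ 𝒞.bounds, (∀ n, 0 < g n) ∧ ∀ n, ∀ i ≤ b * n, a * (n + 1) + f i ≤ g n := by
  set c := a + b + 1 with hc
  refine ⟨_, 𝒞.rescale f hf c (by lia), fun n => by lia, fun n i hi => ?_⟩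
  have hlin : n + 1 ≤ f (c * n + c) := le_trans (by nlinarith) (𝒞.le_bound f hf _)
  have hmono : f i ≤ f (c * n + c) := (𝒞.proper f hf).1 (hi.trans (by nlinarith))
  calc a * (n + 1) + f i ≤ a * f (c * n + c) + f (c * n + c) := by gcongr
    _ ≤ c * f (c * n + c) + c := by nlinarith

/-! ### Average-case complexity -/

section AverageCase

variable {X Y : Type} [Finite X] [Finite Y]

theorem tsum_eq_tsum_sum_wordsOfLength (g : List X → ℝ≥0∞) :
    ∑' w, g w = ∑' n, ∑ w ∈ wordsOfLength X n, g w := by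
  rw [← ENNReal.tsum_fiberwise g List.length]
  refine tsum_congr fun n => ?_
  have hn : List.length ⁻¹' {n} = (wordsOfLength X n : Set (List X)) :=
    (Set.Finite.coe_toFinset _).symm
  rw [hn, Finset.tsum_subtype']

theorem LengthInvariant.sum_mul_div_le {μ : PMF (List X)} (hμ : LengthInvariant μ)
    {T : List X → ℕ} {C : ℝ≥0} {n m : ℕ}
    (h : (∑ w ∈ wordsOfLength X n, (T w : ℝ)) ≤ C * m * (wordsOfLength X n).card) :
    ∑ w ∈ wordsOfLength X n, (T w : ℝ≥0∞) / m * μ w ≤ C * ∑ w ∈ wordsOfLength X n, μ w := by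
  obtain hW | ⟨w₀, h₀⟩ := (wordsOfLength X n).eq_empty_or_nonempty
  · rw [hW, Finset.sum_empty, Finset.sum_empty, mul_zero]
  have hconst : ∀ w ∈ wordsOfLength X n, μ w = μ w₀ := fun w hw =>
    hμ w w₀ ((mem_wordsOfLength.1 hw).trans (mem_wordsOfLength.1 h₀).symm)
  have hsum : ∑ w ∈ wordsOfLength X n, (T w : ℝ≥0∞) ≤ C * (wordsOfLength X n).card * m := by
    rw [mul_right_comm]
    exact_mod_cast h
  calc ∑ w ∈ wordsOfLength X n, (T w : ℝ≥0∞) / m * μ w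
      = (∑ w ∈ wordsOfLength X n, (T w : ℝ≥0∞)) / m * μ w₀ := by
        simp only [div_eq_mul_inv]
        rw [Finset.sum_mul, Finset.sum_mul]
        exact Finset.sum_congr rfl fun w hw => by rw [hconst w hw]
    _ ≤ C * (wordsOfLength X n).card * μ w₀ := by
        gcongr
        exact ENNReal.div_le_of_le_mul hsum
    _ = C * ∑ w ∈ wordsOfLength X n, μ w := by
        rw [Finset.sum_congr rfl hconst, Finset.sum_const, nsmul_eq_mul, mul_assoc]

theorem LengthInvariant.tsum_div_mul_le {μ : PMF (List X)} (hμ : LengthInvariant μ)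
    {T : List X → ℕ} {f : ℕ → ℕ} {C : ℝ≥0}
    (h : ∀ n, (∑ w ∈ wordsOfLength X n, (T w : ℝ)) ≤ C * f n * (wordsOfLength X n).card) :
    ∑' w, (T w : ℝ≥0∞) / f w.length * μ w ≤ C := by
  rw [tsum_eq_tsum_sum_wordsOfLength]
  calc ∑' n, ∑ w ∈ wordsOfLength X n, (T w : ℝ≥0∞) / f w.length * μ w
      ≤ ∑' n, C * ∑ w ∈ wordsOfLength X n, μ w := ENNReal.tsum_le_tsum fun n => by
        refine (Finset.sum_congr rfl fun w hw => ?_).trans_le (hμ.sum_mul_div_le (h n))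
        rw [mem_wordsOfLength.1 hw]
    _ = C := by
        rw [ENNReal.tsum_mul_left, ← tsum_eq_tsum_sum_wordsOfLength, μ.tsum_coe, mul_one]

open Classical in
theorem IsExponentiallyNegligible.exists_card_mul_le {D : Language X}
    (hD : IsExponentiallyNegligible D) {g : ℕ → ℕ} (hg : Subexponential g) :
    ∃ R : ℝ≥0, ∀ n, (((wordsOfLength X n).filter (· ∈ D)).card : ℝ) * g n ≤
      R * (wordsOfLength X n).card := by
  obtain ⟨r, hr, hr1, hcard⟩ := hD
  obtain ⟨R, hR⟩ := hg.exists_le_mul_pow ((one_lt_inv₀ hr).2 hr1)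
  refine ⟨R, fun n => ?_⟩
  calc (((wordsOfLength X n).filter (· ∈ D)).card : ℝ) * g n
      ≤ r ^ n * (wordsOfLength X n).card * (R * r⁻¹ ^ n) := by gcongr; exacts [hcard n, hR n]
    _ = R * (wordsOfLength X n).card := by
        rw [inv_pow]
        field_simp

open Classical in
theorem IsExponentiallyNegligible.exists_sum_le {D : Language X}
    (hD : IsExponentiallyNegligible D) {T : List X → ℕ} {f g : ℕ → ℕ} (hg : Subexponential g)
    (hf : ∀ n, 0 < f n) (hT : ∀ w, T w ≤ f w.length + if w ∈ D then g w.length else 0) :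
    ∃ C : ℝ≥0, ∀ n,
      (∑ w ∈ wordsOfLength X n, (T w : ℝ)) ≤ C * f n * (wordsOfLength X n).card := by
  obtain ⟨R, hR⟩ := hD.exists_card_mul_le hg
  refine ⟨1 + R, fun n => ?_⟩
  set W := wordsOfLength X n
  have hf1 : (1 : ℝ) ≤ f n := Nat.one_le_cast.2 (hf n)
  have hTn : ∀ w ∈ W, (T w : ℝ) ≤ f n + if w ∈ D then (g n : ℝ) else 0 := fun w hw => by
    exact_mod_cast mem_wordsOfLength.1 hw ▸ hT w
  calc ∑ w ∈ W, (T w : ℝ) ≤ ∑ w ∈ W, (f n + if w ∈ D then (g n : ℝ) else 0) :=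
        Finset.sum_le_sum hTn
    _ = W.card * f n + (W.filter (· ∈ D)).card * g n := by
        rw [Finset.sum_add_distrib, Finset.sum_const, nsmul_eq_mul, ← Finset.sum_filter,
          Finset.sum_const, nsmul_eq_mul]
    _ ≤ W.card * f n + R * W.card * f n :=
        add_le_add le_rfl ((hR n).trans (le_mul_of_one_le_right (by positivity) hf1))
    _ = (1 + R : ℝ≥0) * f n * W.card := by
        push_cast
        ring

theorem solvableOnAverageIn_of_le_preimage (T : Transducer X Y) {𝒞 : TimeClass} {D : Language X}
    {E : Language Y} (hD : D ∈ SubExp X) (hE : E ∈ 𝒞.languages Y) (hDE : D ≤ T.preimage E)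
    (hT : IsExponentiallyNegligible (T.preimage E)) :
    SolvableOnAverageIn D 𝒞 {μ : PMF (List X) | LengthInvariant μ} := by
  obtain ⟨g, hg, K, hK, hKg⟩ := hD
  obtain ⟨f₀, hf₀, M, hM, hMf⟩ := hE
  obtain ⟨f, hf, hpos, hle⟩ :=
    𝒞.exists_linear_add_comp_mul_le hf₀ (2 * T.bound + 2) T.bound
  have htime : ∀ w, (TuringMachine.guard T M K).time w ≤
      f w.length + open Classical in if w ∈ T.preimage E then g w.length else 0 := fun w => by
    refine (TuringMachine.guard_time_le hM hK w).trans (add_le_add ?_ ?_)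
    · exact (Nat.add_le_add_left (hMf _) _).trans (hle _ _ (T.length_translateFrom_le _ w))
    · split_ifs
      exacts [hKg w, le_rfl]
  obtain ⟨C, hC⟩ := hT.exists_sum_le hg hpos htime
  exact ⟨.guard T M K, f, hf, inf_eq_right.2 hDE ▸ TuringMachine.guard_decides hM hK,
    (𝒞.proper f hf).1, hpos, C, fun _ hμ => LengthInvariant.tsum_div_mul_le hμ hC⟩

end AverageCase

theorem theoremA_general {G : Type*} [Group G] (hG : WordProblemIn G SubExp)
    (H : Subgroup G) [H.FiniteIndex] {G₁ : Type*} [Group G₁] (φ : H →* G₁)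
    (hφ : Function.Surjective φ) (hG₁ : ¬ IsAmenableGroup G₁)
    (𝒞 : TimeClass) (hWP : WordProblemIn G₁ 𝒞.languages)
    (A : Type) [Finite A] (π : A → G) (hπ : Subgroup.closure (Set.range π) = ⊤) :
    SolvableOnAverageIn (wordProblem π) 𝒞 {μ : PMF (List (A × Bool)) | LengthInvariant μ} := by
  obtain ⟨B, _, ρ, hρ, hE⟩ := hWP
  obtain ⟨T, hT⟩ := exists_transducer_preimage_wordProblem π φ hρ
  refine solvableOnAverageIn_of_le_preimage T (hG.wordProblem_mem_subExp π) hE ?_ ?_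
  · exact hT ▸ wordProblem_le_membershipProblem π _
  · exact hT ▸ isExponentiallyNegligible_membershipProblem_map_ker hφ hG₁ hπ

theorem theoremA {G : Type*} [Group G] [Group.IsFinitelyPresented G]
    (hG : WordProblemIn G SubExp)
    (H : Subgroup G) [H.FiniteIndex]
    {G₁ : Type*} [Group G₁] (φ : H →* G₁) (hφ : Function.Surjective φ)
    (hG₁ : ¬ IsAmenableGroup G₁)
    (𝒞 : TimeClass) (h𝒞 : ∀ X : Type, 𝒞.languages X ⊆ SubExp X)
    (hWP : WordProblemIn G₁ 𝒞.languages)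
    (A : Type) [Finite A] (π : A → G) (hπ : Subgroup.closure (Set.range π) = ⊤) :
    SolvableOnAverageIn (wordProblem π) 𝒞 {μ : PMF (List (A × Bool)) | LengthInvariant μ} :=
  theoremA_general hG H φ hφ hG₁ 𝒞 hWP A π hπ
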